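/- Let $\mathcal N$ be a finite set of players. For each $i\in\mathcal N$ let $\mathbb H_i$ be the real Euclidean space of $M_i\times M_i$ complex Hermitian matrices with inner product $\operatorname{tr}(XY)$, let $A_i>0$, and let $$\mathcal X_i=\{X_i\in\mathbb H_i : X_i\succcurlyeq 0,\ \|X_i\|\le A_i\},\qquad \mathcal X=\prod_{i}\mathcal X_i,$$ where $\|X_i\|$ is the nuclear norm (the sum of the absolute values of the eigenvalues). Player $i$ chooses $X_i\in\mathcal X_i$ to maximize a payoff $u_i(X)=u_i(X_i;X_{-i})$, $X\in\mathcal X$. Assume that each $u_i$ is concave and differentiable in $X_i\in\mathcal X_i$ and that its individual gradient $V_i(X)=\nabla_{X_i}u_i(X)$ is continuously differentiable on $\mathcal X$ (at boundary points, derivatives are taken relative to $\mathcal X$). The Hessian of the game is the block operator $D(X)=(D_{ij}(X))_{i,j}$ on $\prod_i\mathbb H_i$ with blocks $$D_{ij}(X)=\tfrac12\nabla_{X_i}\nabla_{X_j}u_j(X)+\tfrac12\big[\nabla_{X_j}\nabla_{X_i}u_i(X)\big]^\dagger .$$ A profile $X^*\in\mathcal X$ is a Nash equilibrium if $u_i(X^*)\ge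 u_i(X_i;X^*_{-i})$ for all $i$ and all $X_i\in\mathcal X_i$. Matrix exponential learning (MXL) starts from arbitrary Hermitian matrices $Y_i(0)$ and iterates, for $n=0,1,2,\dots$, $$X_i(n)=A_i\,\frac{\exp(Y_i(n))}{1+\|\exp(Y_i(n))\|},\qquad Y_i(n+1)=Y_i(n)+\gamma_n\,\tfrac12\big(\hat V_i(n)+\hat V_i(n)^\dagger\big),\qquad \hat V_i(n)=V_i(X(n))+Z_i(n),$$ where the step sizes $\gamma_n>0$ satisfy $\sum_n\gamma_n^2<\infty$ and $\sum_n\gamma_n=\infty$, and where the random complex matrices $Z(n)=\operatorname{diag}(Z_i(n))_i$ satisfy, for all $n$, $$\mathbb E[Z(n)\mid X(n)]=0,\qquad \mathbb E\big[\|Z(n)\|_*^2\mid X(n)\big]\le\sigma_*^2$$ for some constant $\sigma_*>0$; here $\|\cdot\|_*$ is the largest singular value (for a Hermitian matrix, the largest absolute value of an eigenvalue). If $D(X)$ is negative definite for every $X\in\mathcal X$, then the game has a unique Nash equilibrium $X^*$, and for every such run of MXL, $X(n)\to X^*$ almost surely. -/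

import Mathlib

open Set Filter Topology MeasureTheory
open scoped Matrix ComplexOrder

noncomputable section

/-! ### The Euclidean space of Hermitian matrices -/

/-- The real vector space of `m × m` complex Hermitian matrices. -/
def Herm (m : ℕ) : Type := selfAdjoint (Matrix (Fin m) (Fin m) ℂ)

namespace Herm

variable {m : ℕ}

instance : AddCommGroup (Herm m) :=
  inferInstanceAs (AddCommGroup (selfAdjoint (Matrix (Fin m) (Fin m) ℂ)))

instance : Module ℝ (Herm m) :=
  inferInstanceAs (Module ℝ (selfAdjoint (Matrix (Fin m) (Fin m) ℂ)))

/-- The underlying complex matrix. -/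
def toMatrix (X : Herm m) : Matrix (Fin m) (Fin m) ℂ :=
  Subtype.val (p := fun A => A ∈ selfAdjoint (Matrix (Fin m) (Fin m) ℂ)) X

theorem isHermitian (X : Herm m) : X.toMatrix.IsHermitian :=
  Subtype.property (p := fun A => A ∈ selfAdjoint (Matrix (Fin m) (Fin m) ℂ)) X

/-- A Hermitian matrix as an element of `Herm m`. -/
def mk (A : Matrix (Fin m) (Fin m) ℂ) (hA : A.IsHermitian) : Herm m :=
  Subtype.mk (p := fun A => A ∈ selfAdjoint (Matrix (Fin m) (Fin m) ℂ)) A hA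

@[simp] theorem toMatrix_mk (A : Matrix (Fin m) (Fin m) ℂ) (hA : A.IsHermitian) :
    (mk A hA).toMatrix = A := rfl

@[simp] theorem toMatrix_add (X Y : Herm m) : (X + Y).toMatrix = X.toMatrix + Y.toMatrix := rfl

@[simp] theorem toMatrix_smul (r : ℝ) (X : Herm m) : (r • X).toMatrix = r • X.toMatrix := rfl

@[simp] theorem toMatrix_zero : (0 : Herm m).toMatrix = 0 := rfl

theorem toMatrix_injective : Function.Injective (toMatrix (m := m)) :=
  fun _ _ h => Subtype.ext h

/-- The trace inner product `⟪X, Y⟫ = tr (X Y)`, which is real for Hermitian `X`, `Y`. -/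
@[reducible] def innerCore : InnerProductSpace.Core ℝ (Herm m) where
  inner X Y := (X.toMatrix * Y.toMatrix).trace.re
  conj_inner_symm X Y := by
    change (Y.toMatrix * X.toMatrix).trace.re = (X.toMatrix * Y.toMatrix).trace.re
    rw [Matrix.trace_mul_comm]
  re_inner_nonneg X := by
    change 0 ≤ (X.toMatrix * X.toMatrix).trace.re
    have h := (Matrix.posSemidef_conjTranspose_mul_self X.toMatrix).trace_nonneg
    rw [X.isHermitian.eq] at h
    exact (Complex.le_def.1 h).1
  add_left X Y W := by
    change ((X + Y).toMatrix * W.toMatrix).trace.re = _ + _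
    rw [toMatrix_add, add_mul, Matrix.trace_add, Complex.add_re]
  smul_left X Y r := by
    change ((r • X).toMatrix * Y.toMatrix).trace.re = r * (X.toMatrix * Y.toMatrix).trace.re
    rw [toMatrix_smul, Matrix.smul_mul, Matrix.trace_smul, Complex.smul_re, smul_eq_mul]
  definite X h := by
    have h0 : (X.toMatrix * X.toMatrix).trace.re = 0 := h
    have h1 := (Matrix.posSemidef_conjTranspose_mul_self X.toMatrix).trace_nonneg
    rw [X.isHermitian.eq] at h1
    have h2 : (X.toMatrix * X.toMatrix).trace = 0 :=
      Complex.ext h0 (Complex.le_def.1 h1).2.symm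
    apply toMatrix_injective
    have h3 : (X.toMatrixᴴ * X.toMatrix).trace = 0 := by rw [X.isHermitian.eq]; exact h2
    simpa using Matrix.trace_conjTranspose_mul_self_eq_zero_iff.1 h3

instance : NormedAddCommGroup (Herm m) := innerCore.toNormedAddCommGroup

instance : InnerProductSpace ℝ (Herm m) := InnerProductSpace.ofCore innerCore.toCore

instance : FiniteDimensional ℝ (Herm m) :=
  inferInstanceAs (FiniteDimensional ℝ
    (selfAdjoint.submodule ℝ (Matrix (Fin m) (Fin m) ℂ)))

instance : CompleteSpace (Herm m) := FiniteDimensional.complete ℝ (Herm m)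

instance : MeasurableSpace (Herm m) := borel (Herm m)

instance : BorelSpace (Herm m) := ⟨rfl⟩

/-- The nuclear (trace) norm: the sum of the absolute values of the eigenvalues. -/
def nuclearNorm (X : Herm m) : ℝ := ∑ k, |X.isHermitian.eigenvalues k|

/-- The matrix exponential of a Hermitian matrix. -/
def exp (Y : Herm m) : Herm m := mk (NormedSpace.exp Y.toMatrix) Y.isHermitian.exp

/-- The Hermitian part `(A + Aᴴ) / 2` of a complex matrix. -/
def ofMatrix (A : Matrix (Fin m) (Fin m) ℂ) : Herm m :=
  mk ((1 / 2 : ℝ) • (A + A.conjTranspose)) (by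
    simp [Matrix.IsHermitian, add_comm])

/-- The exponential projection `Y ↦ a exp(Y) / (1 + ‖exp(Y)‖)`. -/
def expProj (a : ℝ) (Y : Herm m) : Herm m := (a / (1 + Y.exp.nuclearNorm)) • Y.exp

end Herm

/-- The singular norm (largest singular value) of a complex matrix, that is, its operator norm on
Euclidean space; for a Hermitian matrix it is the largest absolute value of an eigenvalue. -/
def singularNorm {m : ℕ} (A : Matrix (Fin m) (Fin m) ℂ) : ℝ :=
  ‖Matrix.toEuclideanCLM (n := Fin m) (𝕜 := ℂ) A‖

/-! ### Games with matrix variables -/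

/-- The data of a game with player set `ι`: player `i` controls an `M i × M i` Hermitian matrix,
has trace budget `A i > 0` and payoff function `u i`. -/
structure MatrixGame (ι : Type*) where
  M : ι → ℕ
  A : ι → ℝ
  A_pos : ∀ i, 0 < A i
  u : ι → (∀ j, Herm (M j)) → ℝ

namespace MatrixGame

variable {ι : Type*} (G : MatrixGame ι)

/-- Profiles of Hermitian matrices, one for each player. -/
abbrev Profile : Type _ := ∀ i, Herm (G.M i)

/-- The feasible actions of player `i`: `X ≽ 0` with nuclear norm at most `A i`. -/
def actions (i : ι) : Set (Herm (G.M i)) :=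
  {X | X.toMatrix.PosSemidef ∧ X.nuclearNorm ≤ G.A i}

/-- The feasible profiles. -/
def feasible : Set G.Profile := {X | ∀ i, X i ∈ G.actions i}

section

variable [DecidableEq ι]

/-- Nash equilibrium: no player gains by deviating unilaterally. -/
def IsNash (X : G.Profile) : Prop :=
  X ∈ G.feasible ∧ ∀ i, ∀ Y ∈ G.actions i, G.u i (Function.update X i Y) ≤ G.u i X

/-- Every payoff function is concave in the player's own action. -/
def IndividuallyConcave : Prop :=
  ∀ i, ∀ X ∈ G.feasible, ConcaveOn ℝ (G.actions i) fun Y => G.u i (Function.update X i Y)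

/-- The individual payoff gradient `V_i(X)` of player `i`: the gradient, for the trace inner
product, of `u_i(· ; X_{-i})` at `X_i`. At boundary points of the feasible set (a convex body)
derivatives are taken relative to that set. -/
def grad (i : ι) (X : G.Profile) : Herm (G.M i) :=
  gradientWithin (fun Y => G.u i (Function.update X i Y)) (G.actions i) (X i)

/-- The partial derivative `∇_{X_j} V_i(X) = ∇_{X_j} ∇_{X_i} u_i(X)`, as a linear map from
directions of player `j` to Hermitian matrices of player `i`. -/
def gradDeriv (i j : ι) (X : G.Profile) : Herm (G.M j) →L[ℝ] Herm (G.M i) :=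
  fderivWithin ℝ (fun Y => G.grad i (Function.update X j Y)) (G.actions j) (X j)

/-- The `(i, j)` block
`D_{ij} = (1/2) ∇_{X_i} ∇_{X_j} u_j + (1/2) [∇_{X_j} ∇_{X_i} u_i]†` of the Hessian of the game.
The rows of a mixed derivative `∇_{X_i} ∇_{X_j} u_j` are indexed by `X_i` and its columns by
`X_j`, so it acts from the `j`-th to the `i`-th space as the transpose of `∇_{X_i} V_j`. -/
def hessianBlock (i j : ι) (X : G.Profile) : Herm (G.M j) →L[ℝ] Herm (G.M i) :=
  (1 / 2 : ℝ) • ContinuousLinearMap.adjoint (G.gradDeriv j i X) +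
    (1 / 2 : ℝ) • G.gradDeriv i j X

variable [Fintype ι]

/-- The payoffs are smooth enough for the gradients and the Hessian to be defined classically:
`u_i` is differentiable in `X_i` and its individual gradient is continuously differentiable on the
feasible set. -/
def IndividuallySmooth : Prop :=
  (∀ i, ∀ X ∈ G.feasible, DifferentiableWithinAt ℝ
    (fun Y => G.u i (Function.update X i Y)) (G.actions i) (X i)) ∧
  ∀ i, ContDiffOn ℝ 1 (G.grad i) G.feasible

/-- The Hessian `D(X) = (D_{ij}(X))` of the game is negative definite. -/
def HessianNegDef (X : G.Profile) : Prop :=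
  ∀ H : G.Profile, H ≠ 0 → ∑ i, ∑ j, inner ℝ (H i) (G.hessianBlock i j X (H j)) < 0

end

/-! ### Matrix exponential learning -/

/-- Profiles of complex (not necessarily Hermitian) matrices. -/
abbrev MatrixProfile : Type _ := ∀ i, Matrix (Fin (G.M i)) (Fin (G.M i)) ℂ

/-- The profile of actions induced by a profile of scores. -/
def choice (Y : G.Profile) : G.Profile := fun i => Herm.expProj (G.A i) (Y i)

/-- The score matrices `Y(n)` of matrix exponential learning with step sizes `γ`, initial scores
`Y₀` and a realization `z` of the noise: the gradient estimate of player `i` at stage `n` is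
`V_i(X(n)) + z_i(n)`, replaced by its Hermitian part. -/
def score [DecidableEq ι] (γ : ℕ → ℝ) (Y₀ : G.Profile) (z : ℕ → G.MatrixProfile) :
    ℕ → G.Profile
  | 0 => Y₀
  | n + 1 => fun i => score γ Y₀ z n i +
      γ n • Herm.ofMatrix ((G.grad i (G.choice (score γ Y₀ z n))).toMatrix + z n i)

/-- The actions `X(n)` of matrix exponential learning. -/
def mxl [DecidableEq ι] (γ : ℕ → ℝ) (Y₀ : G.Profile) (z : ℕ → G.MatrixProfile) (n : ℕ) :
    G.Profile :=
  G.choice (G.score γ Y₀ z n)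

/-- The singular norm of the block-diagonal matrix `diag(Z_i)`. -/
def blockNorm (Z : G.MatrixProfile) : ℝ := ⨆ i, singularNorm (Z i)

/-- The noise process `Z` of matrix exponential learning consists of random matrices with zero mean
and mean square at most `σ²` conditionally on the current action profile `X(n)`. -/
structure IsAdmissibleNoise [DecidableEq ι] {Ω : Type*} [MeasurableSpace Ω] (μ : Measure Ω)
    (γ : ℕ → ℝ) (Y₀ : G.Profile) (Z : ℕ → Ω → G.MatrixProfile) (σ : ℝ) : Prop where
  measurable : ∀ n i a b, Measurable fun ω => Z n ω i a b
  integrable_sq : ∀ n, Integrable (fun ω => G.blockNorm (Z n ω) ^ 2) μ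
  zero_mean : ∀ n i a b,
    μ[fun ω => Z n ω i a b |
      MeasurableSpace.comap (fun ω => G.mxl γ Y₀ (fun k => Z k ω) n) inferInstance] =ᵐ[μ] 0
  mean_sq : ∀ n,
    μ[fun ω => G.blockNorm (Z n ω) ^ 2 |
      MeasurableSpace.comap (fun ω => G.mxl γ Y₀ (fun k => Z k ω) n) inferInstance]
      ≤ᵐ[μ] fun _ => σ ^ 2

end MatrixGame

end

/-!
Negative definiteness of the Hessian makes the individual gradient field `V` strictly monotone.
Hence the variational inequality of `V` has a solution, which is a Nash equilibrium `X*` by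
concavity, and `⟪V(X), X* - X⟫ > 0` at every other feasible profile `X`.

The exponential projection is the gradient of `Y ↦ A log (1 + tr exp Y)`, which is smooth with
Lipschitz gradient. The Fenchel coupling between `X*` and the scores is therefore, in expectation, a
Lyapunov function: it decreases by `γ ⟪V(X), X* - X⟫` at each step, up to an error of order `γ²`.
Summing up, `∑ γ_n ⟪V(X(n)), X* - X(n)⟫` is almost surely finite, even when weighted by the squared
size of the noise. As `∑ γ_n = ∞`, the iterates return to every neighbourhood of `X*`; and the total
distance that they travel away from a neighbourhood is finite, so they eventually stay close.
-/

noncomputable section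

namespace Herm

variable {m : ℕ}

/-- The eigenvalues of a Hermitian matrix, listed with multiplicity. -/
abbrev eigenvalues (X : Herm m) : Fin m → ℝ := X.isHermitian.eigenvalues

/-- The identity matrix. Since `⟪1, X⟫ = tr X`, the trace is written as `inner ℝ (one m) X`. -/
def one (m : ℕ) : Herm m := mk 1 Matrix.isHermitian_one

/-- The Hermitian matrix `f(X)` given by the continuous functional calculus. Every function is
continuous on the (finite) spectrum of `X`, so `f` need not be continuous. -/
def map (f : ℝ → ℝ) (X : Herm m) : Herm m := mk (cfc f X.toMatrix) (cfc_predicate f X.toMatrix)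

/-- The squared modulus of the inner product of the `i`-th eigenvector of `X` and the `j`-th
eigenvector of `Y`: the weights in the spectral expansion of `tr (f(X) g(Y))`. -/
def overlap (X Y : Herm m) (i j : Fin m) : ℝ :=
  Complex.normSq (((X.isHermitian.eigenvectorUnitary : Matrix (Fin m) (Fin m) ℂ)ᴴ *
    (Y.isHermitian.eigenvectorUnitary : Matrix (Fin m) (Fin m) ℂ)) i j)

theorem inner_def (X Y : Herm m) : inner ℝ X Y = (X.toMatrix * Y.toMatrix).trace.re := rfl

theorem overlap_nonneg (X Y : Herm m) (i j : Fin m) : 0 ≤ X.overlap Y i j :=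
  Complex.normSq_nonneg _

theorem toMatrix_map (f : ℝ → ℝ) (X : Herm m) : (X.map f).toMatrix =
    (X.isHermitian.eigenvectorUnitary : Matrix (Fin m) (Fin m) ℂ) *
      Matrix.diagonal (fun k => (f (X.eigenvalues k) : ℂ)) *
      (X.isHermitian.eigenvectorUnitary : Matrix (Fin m) (Fin m) ℂ)ᴴ := by
  change cfc f X.toMatrix = _
  rw [X.isHermitian.cfc_eq, Matrix.IsHermitian.cfc, Unitary.conjStarAlgAut_apply]
  rfl

theorem map_id (X : Herm m) : X.map id = X :=
  toMatrix_injective (cfc_id ℝ X.toMatrix X.isHermitian.isSelfAdjoint)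

theorem map_const_one (X : Herm m) : X.map (fun _ => 1) = one m :=
  toMatrix_injective (cfc_const_one ℝ X.toMatrix X.isHermitian.isSelfAdjoint)

open scoped Matrix.Norms.L2Operator in
theorem map_exp (X : Herm m) : X.map Real.exp = X.exp :=
  toMatrix_injective (CFC.real_exp_eq_normedSpace_exp X.isHermitian.isSelfAdjoint)

theorem inner_map_map (X Y : Herm m) (f g : ℝ → ℝ) :
    inner ℝ (X.map f) (Y.map g) = ∑ p : Fin m × Fin m, X.overlap Y p.1 p.2 *
      (f (X.eigenvalues p.1) * g (Y.eigenvalues p.2)) := by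
  rw [inner_def, toMatrix_map, toMatrix_map, Fintype.sum_prod_type]
  simp only [overlap]
  generalize (X.isHermitian.eigenvectorUnitary : Matrix (Fin m) (Fin m) ℂ) = U
  generalize (Y.isHermitian.eigenvectorUnitary : Matrix (Fin m) (Fin m) ℂ) = V
  set a : Fin m → ℝ := fun k => f (X.eigenvalues k)
  set b : Fin m → ℝ := fun k => g (Y.eigenvalues k)
  have trace_eq : (U * Matrix.diagonal (fun k => (a k : ℂ)) * Uᴴ *
      (V * Matrix.diagonal (fun k => (b k : ℂ)) * Vᴴ)).trace =
      ((Matrix.diagonal (fun k => (a k : ℂ)) * (Uᴴ * V)) *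
        (Matrix.diagonal (fun k => (b k : ℂ)) * (Uᴴ * V)ᴴ)).trace := by
    rw [Matrix.conjTranspose_mul, Matrix.conjTranspose_conjTranspose, Matrix.mul_assoc,
      Matrix.mul_assoc U, Matrix.trace_mul_comm U]
    simp only [Matrix.mul_assoc]
  rw [trace_eq]
  generalize Uᴴ * V = W
  simp only [Matrix.trace, Matrix.diag, Matrix.mul_apply (M := _ * W), Matrix.diagonal_mul,
    Matrix.conjTranspose_apply, Complex.re_sum]
  refine Finset.sum_congr rfl fun i _ => Finset.sum_congr rfl fun j _ => ?_
  have entry_eq : (a i : ℂ) * W i j * ((b j : ℂ) * star (W i j)) =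
      ((Complex.normSq (W i j) * (a i * b j) : ℝ) : ℂ) := by
    push_cast
    rw [← Complex.mul_conj, RCLike.star_def]
    ring
  rw [entry_eq, Complex.ofReal_re]

theorem inner_map_map_self (X : Herm m) (f g : ℝ → ℝ) :
    inner ℝ (X.map f) (X.map g) = ∑ i, f (X.eigenvalues i) * g (X.eigenvalues i) := by
  have unitary_mul : (X.isHermitian.eigenvectorUnitary : Matrix (Fin m) (Fin m) ℂ)ᴴ *
      (X.isHermitian.eigenvectorUnitary : Matrix (Fin m) (Fin m) ℂ) = 1 :=
    Unitary.coe_star_mul_self _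
  simp [inner_map_map, Fintype.sum_prod_type, overlap, unitary_mul, Matrix.one_apply, apply_ite]

theorem inner_one_map (X : Herm m) (f : ℝ → ℝ) :
    inner ℝ (one m) (X.map f) = ∑ i, f (X.eigenvalues i) := by
  simpa only [map_const_one, one_mul] using inner_map_map_self X (fun _ => 1) f

theorem inner_one_left_eq_sum_eigenvalues (X : Herm m) :
    inner ℝ (one m) X = ∑ i, X.eigenvalues i := by
  simpa only [map_id, id_eq] using inner_one_map X id

theorem sum_overlap_mul_left (X Y : Herm m) (f : ℝ → ℝ) :
    ∑ p : Fin m × Fin m, X.overlap Y p.1 p.2 * f (X.eigenvalues p.1) =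
      ∑ i, f (X.eigenvalues i) := by
  rw [← inner_one_map, real_inner_comm, ← map_const_one Y, inner_map_map]
  simp only [mul_one]

theorem sum_overlap_mul_right (X Y : Herm m) (f : ℝ → ℝ) :
    ∑ p : Fin m × Fin m, X.overlap Y p.1 p.2 * f (Y.eigenvalues p.2) =
      ∑ j, f (Y.eigenvalues j) := by
  rw [← inner_one_map, ← map_const_one X, inner_map_map]
  simp only [one_mul]

theorem norm_map_sub_map_sq (X Y : Herm m) (f : ℝ → ℝ) :
    ‖X.map f - Y.map f‖ ^ 2 = ∑ p : Fin m × Fin m, X.overlap Y p.1 p.2 *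
      (f (X.eigenvalues p.1) - f (Y.eigenvalues p.2)) ^ 2 := by
  rw [norm_sub_sq_real, ← real_inner_self_eq_norm_sq, ← real_inner_self_eq_norm_sq,
    inner_map_map_self, inner_map_map_self, inner_map_map,
    ← sum_overlap_mul_left X Y (fun x => f x * f x),
    ← sum_overlap_mul_right X Y (fun x => f x * f x),
    Finset.mul_sum, ← Finset.sum_sub_distrib, ← Finset.sum_add_distrib]
  exact Finset.sum_congr rfl fun p _ => by ring

theorem norm_map_sub_map_le {f : ℝ → ℝ} {s : Set ℝ} {C : NNReal} (hf : LipschitzOnWith C f s)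
    {X Y : Herm m} (hX : ∀ i, X.eigenvalues i ∈ s) (hY : ∀ i, Y.eigenvalues i ∈ s) :
    ‖X.map f - Y.map f‖ ≤ C * ‖X - Y‖ := by
  refine le_of_sq_le_sq ?_ (by positivity)
  have norm_sub_sq := norm_map_sub_map_sq X Y id
  rw [map_id, map_id] at norm_sub_sq
  rw [mul_pow, norm_map_sub_map_sq, norm_sub_sq, Finset.mul_sum]
  refine Finset.sum_le_sum fun p _ => ?_
  rw [mul_left_comm, ← mul_pow]
  refine mul_le_mul_of_nonneg_left (sq_le_sq.2 ?_) (overlap_nonneg X Y _ _)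
  rw [abs_mul, NNReal.abs_eq]
  exact hf.dist_le_mul _ (hX p.1) _ (hY p.2)

/-- Klein's inequality. -/
theorem inner_map_sub_le {φ ψ : ℝ → ℝ} {X Y : Herm m}
    (h : ∀ i j, ψ (Y.eigenvalues j) * (X.eigenvalues i - Y.eigenvalues j) ≤
      φ (X.eigenvalues i) - φ (Y.eigenvalues j)) :
    inner ℝ (Y.map ψ) (X - Y) ≤ inner ℝ (one m) (X.map φ) - inner ℝ (one m) (Y.map φ) := by
  have inner_X := inner_map_map X Y id ψ
  have inner_Y := inner_map_map_self Y ψ id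
  rw [map_id] at inner_X inner_Y
  rw [inner_sub_right, real_inner_comm, inner_X, inner_Y, inner_one_map, inner_one_map,
    ← sum_overlap_mul_left X Y, ← sum_overlap_mul_right X Y φ,
    ← sum_overlap_mul_right X Y fun x => ψ x * id x, ← Finset.sum_sub_distrib,
    ← Finset.sum_sub_distrib]
  refine Finset.sum_le_sum fun p _ => ?_
  rw [← mul_sub, ← mul_sub]
  refine mul_le_mul_of_nonneg_left ?_ (overlap_nonneg X Y _ _)
  simp only [id_eq]
  linear_combination h p.1 p.2

end Herm

namespace Herm

variable {m : ℕ}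

theorem posSemidef_map {f : ℝ → ℝ} {X : Herm m} (hf : ∀ k, 0 ≤ f (X.eigenvalues k)) :
    (X.map f).toMatrix.PosSemidef := by
  rw [toMatrix_map]
  refine Matrix.PosSemidef.mul_mul_conjTranspose_same (Matrix.PosSemidef.diagonal fun k => ?_) _
  exact Complex.zero_le_real.2 (hf k)

theorem posSemidef_exp (Y : Herm m) : Y.exp.toMatrix.PosSemidef := by
  rw [← map_exp]
  exact posSemidef_map fun _ => (Real.exp_pos _).le

theorem nuclearNorm_of_posSemidef {X : Herm m} (hX : X.toMatrix.PosSemidef) :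
    X.nuclearNorm = inner ℝ (one m) X := by
  rw [inner_one_left_eq_sum_eigenvalues]
  exact Finset.sum_congr rfl fun k _ => abs_of_nonneg (hX.eigenvalues_nonneg k)

theorem nuclearNorm_nonneg (X : Herm m) : 0 ≤ X.nuclearNorm :=
  Finset.sum_nonneg fun _ _ => abs_nonneg _

theorem norm_sq_eq_sum_eigenvalues (X : Herm m) : ‖X‖ ^ 2 = ∑ i, X.eigenvalues i ^ 2 := by
  have inner_self := inner_map_map_self X id id
  rw [map_id, real_inner_self_eq_norm_sq] at inner_self
  simpa only [sq, id_eq] using inner_self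

theorem abs_eigenvalues_le_norm (X : Herm m) (k : Fin m) : |X.eigenvalues k| ≤ ‖X‖ := by
  refine abs_le_of_sq_le_sq ?_ (norm_nonneg X)
  rw [norm_sq_eq_sum_eigenvalues]
  exact Finset.single_le_sum (fun i _ => sq_nonneg (X.eigenvalues i)) (Finset.mem_univ k)

theorem norm_le_nuclearNorm (X : Herm m) : ‖X‖ ≤ X.nuclearNorm := by
  refine le_of_sq_le_sq ?_ X.nuclearNorm_nonneg
  rw [norm_sq_eq_sum_eigenvalues]
  simp_rw [← sq_abs (X.eigenvalues _)]
  exact Finset.sum_sq_le_sq_sum_of_nonneg fun _ _ => abs_nonneg _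

theorem map_const_add (c : ℝ) (X : Herm m) : X.map (fun x => c + x) = c • one m + X := by
  apply toMatrix_injective
  have h := cfc_const_add c id X.toMatrix continuousOn_id X.isHermitian.isSelfAdjoint
  rw [cfc_id ℝ X.toMatrix X.isHermitian.isSelfAdjoint, Algebra.algebraMap_eq_smul_one] at h
  exact h

theorem posSemidef_smul_one_add {X : Herm m} {c : ℝ} (hX : ‖X‖ ≤ c) :
    (c • one m + X).toMatrix.PosSemidef := by
  rw [← map_const_add]
  exact posSemidef_map fun k =>
    neg_le_iff_add_nonneg'.1 (neg_le_of_abs_le ((abs_eigenvalues_le_norm X k).trans hX))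

theorem exp_sub_smul_one (Y : Herm m) (c : ℝ) :
    (Y - c • one m).exp = Real.exp (-c) • Y.exp := by
  apply toMatrix_injective
  change NormedSpace.exp (Y.toMatrix - c • (1 : Matrix (Fin m) (Fin m) ℂ)) =
    Real.exp (-c) • NormedSpace.exp Y.toMatrix
  have smul_one_eq_diagonal :
      (-c) • (1 : Matrix (Fin m) (Fin m) ℂ) = Matrix.diagonal fun _ => ((-c : ℝ) : ℂ) := by
    ext i j
    by_cases h : i = j <;> simp [h]
  rw [sub_eq_add_neg, ← neg_smul, Matrix.exp_add_of_commute _ _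
    ((Commute.one_right _).smul_right _), smul_one_eq_diagonal, Matrix.exp_diagonal]
  ext i j
  simp [Pi.coe_exp, ← Complex.exp_eq_exp_ℂ, mul_comm]

/-- The convex potential `log (1 + tr exp Y)` whose gradient is the exponential projection of
unit budget. -/
def logPartition (Y : Herm m) : ℝ := Real.log (1 + Y.exp.nuclearNorm)

/-- The score shifted by its log-partition function, so that `exp` of it is the exponential
projection of unit budget. -/
def normalized (Y : Herm m) : Herm m := Y - Y.logPartition • one m

theorem exp_logPartition (Y : Herm m) :
    Real.exp Y.logPartition = 1 + inner ℝ (one m) Y.exp := by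
  rw [← nuclearNorm_of_posSemidef Y.posSemidef_exp]
  exact Real.exp_log (by linarith [Y.exp.nuclearNorm_nonneg])

theorem logPartition_nonneg (Y : Herm m) : 0 ≤ Y.logPartition :=
  Real.log_nonneg (by linarith [Y.exp.nuclearNorm_nonneg])

theorem exp_normalized (Y : Herm m) : Y.normalized.exp = (1 + Y.exp.nuclearNorm)⁻¹ • Y.exp := by
  rw [normalized, exp_sub_smul_one, Real.exp_neg, exp_logPartition,
    nuclearNorm_of_posSemidef Y.posSemidef_exp]

theorem expProj_eq (a : ℝ) (Y : Herm m) : expProj a Y = a • Y.normalized.exp := by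
  rw [exp_normalized, expProj, smul_smul, div_eq_mul_inv]

theorem inner_one_exp_normalized (Y : Herm m) :
    inner ℝ (one m) Y.normalized.exp = 1 - Real.exp (-Y.logPartition) := by
  rw [normalized, exp_sub_smul_one, inner_smul_right,
    show inner ℝ (one m) Y.exp = Real.exp Y.logPartition - 1 by rw [exp_logPartition]; ring,
    mul_sub, ← Real.exp_add, neg_add_cancel, Real.exp_zero, mul_one]

theorem eigenvalues_normalized_nonpos (Y : Herm m) (k : Fin m) :
    Y.normalized.eigenvalues k ≤ 0 := by
  rw [← Real.exp_le_one_iff]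
  calc Real.exp (Y.normalized.eigenvalues k)
      ≤ ∑ i, Real.exp (Y.normalized.eigenvalues i) :=
        Finset.single_le_sum (fun i _ => (Real.exp_pos _).le) (Finset.mem_univ k)
    _ = 1 - Real.exp (-Y.logPartition) := by
        rw [← inner_one_exp_normalized, ← map_exp, inner_one_map]
    _ ≤ 1 := sub_le_self _ (Real.exp_pos _).le

theorem norm_exp_normalized_le (Y : Herm m) : ‖Y.normalized.exp‖ ≤ 1 := by
  refine (norm_le_nuclearNorm _).trans ?_
  rw [nuclearNorm_of_posSemidef (posSemidef_exp _), inner_one_exp_normalized]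
  exact sub_le_self _ (Real.exp_pos _).le

/-- Klein's inequality for the normalized scores loses the factor `1 - exp (-Λ Y)` on the
difference of the potentials `Λ`; the convexity of `exp (-t)` recovers it. -/
theorem inner_exp_normalized_le (X Y : Herm m) :
    inner ℝ Y.normalized.exp (X - Y) ≤ X.logPartition - Y.logPartition := by
  have klein : inner ℝ Y.normalized.exp (X.normalized - Y.normalized) ≤
      inner ℝ (one m) X.normalized.exp - inner ℝ (one m) Y.normalized.exp := by
    simp only [← map_exp]
    refine inner_map_sub_le fun i j => ?_
    set x := X.normalized.eigenvalues i
    set y := Y.normalized.eigenvalues j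
    calc Real.exp y * (x - y) ≤ Real.exp y * (Real.exp (x - y) - 1) :=
          mul_le_mul_of_nonneg_left (by linarith [Real.add_one_le_exp (x - y)]) (Real.exp_pos y).le
      _ = Real.exp x - Real.exp y := by
          rw [mul_sub, ← Real.exp_add, add_sub_cancel, mul_one]
  have inner_sub : inner ℝ Y.normalized.exp (X.normalized - Y.normalized) =
      inner ℝ Y.normalized.exp (X - Y) -
        (X.logPartition - Y.logPartition) * (1 - Real.exp (-Y.logPartition)) := by
    rw [← inner_one_exp_normalized, real_inner_comm _ (one m), ← inner_smul_right,
      ← inner_sub_right]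
    congr 1
    simp only [normalized]
    module
  have exp_convex : Real.exp (-Y.logPartition) * (Y.logPartition - X.logPartition) ≤
      Real.exp (-X.logPartition) - Real.exp (-Y.logPartition) := by
    rw [show -X.logPartition = -Y.logPartition + (Y.logPartition - X.logPartition) by ring,
      Real.exp_add]
    nlinarith [Real.add_one_le_exp (Y.logPartition - X.logPartition),
      Real.exp_pos (-Y.logPartition)]
  rw [inner_sub, inner_one_exp_normalized, inner_one_exp_normalized] at klein
  linarith

theorem abs_logPartition_sub_le (X Y : Herm m) :
    |X.logPartition - Y.logPartition| ≤ ‖X - Y‖ := by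
  have one_sided (X Y : Herm m) : X.logPartition - Y.logPartition ≤ ‖X - Y‖ := calc
    X.logPartition - Y.logPartition ≤ inner ℝ X.normalized.exp (X - Y) := by
        have := inner_exp_normalized_le Y X
        rw [← neg_sub X Y, inner_neg_right] at this
        linarith
    _ ≤ ‖X.normalized.exp‖ * ‖X - Y‖ := real_inner_le_norm _ _
    _ ≤ ‖X - Y‖ := mul_le_of_le_one_left (norm_nonneg _) X.norm_exp_normalized_le
  exact abs_sub_le_iff.2 ⟨one_sided X Y, norm_sub_rev X Y ▸ one_sided Y X⟩

theorem lipschitzOnWith_real_exp_Iic : LipschitzOnWith 1 Real.exp (Iic 0) := by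
  refine (convex_Iic 0).lipschitzOnWith_of_nnnorm_deriv_le
    (fun x _ => Real.differentiableAt_exp) fun x hx => ?_
  rw [Real.deriv_exp, ← NNReal.coe_le_coe, coe_nnnorm, Real.norm_of_nonneg (Real.exp_pos x).le]
  exact Real.exp_le_one_iff.2 hx

theorem norm_exp_normalized_sub_le (X Y : Herm m) :
    ‖X.normalized.exp - Y.normalized.exp‖ ≤ (1 + ‖one m‖) * ‖X - Y‖ := by
  have exp_le : ‖X.normalized.exp - Y.normalized.exp‖ ≤ ‖X.normalized - Y.normalized‖ := by
    simpa only [map_exp, NNReal.coe_one, one_mul] using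
      norm_map_sub_map_le lipschitzOnWith_real_exp_Iic X.eigenvalues_normalized_nonpos
        Y.eigenvalues_normalized_nonpos
  calc ‖X.normalized.exp - Y.normalized.exp‖
      ≤ ‖X.normalized - Y.normalized‖ := exp_le
    _ = ‖(X - Y) - (X.logPartition - Y.logPartition) • one m‖ := by
        congr 1
        simp only [normalized]
        module
    _ ≤ ‖X - Y‖ + |X.logPartition - Y.logPartition| * ‖one m‖ := by
        rw [← Real.norm_eq_abs, ← norm_smul]
        exact norm_sub_le _ _
    _ ≤ ‖X - Y‖ + ‖X - Y‖ * ‖one m‖ := by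
        gcongr
        exact abs_logPartition_sub_le X Y
    _ = (1 + ‖one m‖) * ‖X - Y‖ := by ring

theorem logPartition_add_le (Y W : Herm m) : (Y + W).logPartition ≤
    Y.logPartition + inner ℝ Y.normalized.exp W + (1 + ‖one m‖) * ‖W‖ ^ 2 := by
  have convexity := inner_exp_normalized_le Y (Y + W)
  rw [sub_add_cancel_left, inner_neg_right] at convexity
  have cauchy_schwarz := real_inner_le_norm ((Y + W).normalized.exp - Y.normalized.exp) W
  rw [inner_sub_left] at cauchy_schwarz
  have lipschitz := mul_le_mul_of_nonneg_right (norm_exp_normalized_sub_le (Y + W) Y)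
    (norm_nonneg W)
  rw [add_sub_cancel_left, mul_assoc, ← sq] at lipschitz
  linarith

theorem inner_nonpos_of_eigenvalues {X Y : Herm m} (hX : ∀ i, X.eigenvalues i ≤ 0)
    (hY : ∀ j, 0 ≤ Y.eigenvalues j) : inner ℝ X Y ≤ 0 := by
  rw [← map_id X, ← map_id Y, inner_map_map]
  exact Finset.sum_nonpos fun p _ => mul_nonpos_of_nonneg_of_nonpos (overlap_nonneg _ _ _ _)
    (mul_nonpos_of_nonpos_of_nonneg (hX p.1) (hY p.2))

/-- The positive semidefinite matrices of nuclear norm at most `a`: the actions of a player with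
budget `a`. -/
def budgetSet (m : ℕ) (a : ℝ) : Set (Herm m) := {X | X.toMatrix.PosSemidef ∧ X.nuclearNorm ≤ a}

theorem inner_le_mul_logPartition {X : Herm m} {a : ℝ} (hX : X ∈ budgetSet m a) (Y : Herm m) :
    inner ℝ Y X ≤ a * Y.logPartition := by
  have inner_nonpos : inner ℝ Y.normalized X ≤ 0 :=
    inner_nonpos_of_eigenvalues Y.eigenvalues_normalized_nonpos hX.1.eigenvalues_nonneg
  rw [normalized, inner_sub_left, real_inner_smul_left, ← nuclearNorm_of_posSemidef hX.1]
    at inner_nonpos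
  linarith [mul_le_mul_of_nonneg_left hX.2 Y.logPartition_nonneg]

theorem continuous_toMatrix : Continuous (toMatrix (m := m)) :=
  ({ toFun := toMatrix, map_add' := toMatrix_add, map_smul' := toMatrix_smul } :
    Herm m →ₗ[ℝ] Matrix (Fin m) (Fin m) ℂ).continuous_of_finiteDimensional

theorem isClosed_posSemidef : IsClosed {X : Herm m | X.toMatrix.PosSemidef} := by
  simp only [Matrix.posSemidef_iff_dotProduct_mulVec, isHermitian, true_and, ofPred_forall]
  exact isClosed_iInter fun x => isClosed_le continuous_const
    (continuous_const.dotProduct (continuous_toMatrix.matrix_mulVec continuous_const))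

theorem budgetSet_eq (m : ℕ) (a : ℝ) :
    budgetSet m a = {X | X.toMatrix.PosSemidef} ∩ {X | inner ℝ (one m) X ≤ a} :=
  Set.ext fun _ => and_congr_right fun h => by rw [nuclearNorm_of_posSemidef h]; rfl

theorem convex_budgetSet (a : ℝ) : Convex ℝ (budgetSet m a) := by
  rw [budgetSet_eq]
  refine Convex.inter ?_ (convex_halfSpace_le (innerₛₗ ℝ (one m)).isLinear a)
  intro X hX Y hY s t hs ht _
  exact (Matrix.PosSemidef.smul hX hs).add (Matrix.PosSemidef.smul hY ht)

theorem isCompact_budgetSet (a : ℝ) : IsCompact (budgetSet m a) := by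
  have := FiniteDimensional.proper ℝ (Herm m)
  refine Metric.isCompact_of_isClosed_isBounded ?_
    (isBounded_iff_forall_norm_le.2 ⟨a, fun X hX => (norm_le_nuclearNorm X).trans hX.2⟩)
  rw [budgetSet_eq]
  exact isClosed_posSemidef.inter (isClosed_le (by fun_prop) continuous_const)

theorem zero_mem_budgetSet {a : ℝ} (ha : 0 ≤ a) : (0 : Herm m) ∈ budgetSet m a := by
  rw [budgetSet_eq]
  exact ⟨Matrix.PosSemidef.zero, (inner_zero_right (one m)).trans_le ha⟩

theorem interior_budgetSet_nonempty {a : ℝ} (ha : 0 < a) : (interior (budgetSet m a)).Nonempty := by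
  set c : ℝ := a / (‖one m‖ ^ 2 + 1) with hc
  have c_pos : 0 < c := by positivity
  have trace_lt : inner ℝ (one m) (c • one m) < a := by
    rw [inner_smul_right, real_inner_self_eq_norm_sq, hc, div_mul_eq_mul_div, div_lt_iff₀]
      <;> nlinarith [sq_nonneg ‖one m‖]
  refine ⟨c • one m, mem_interior_iff_mem_nhds.2 ?_⟩
  rw [budgetSet_eq]
  filter_upwards [Metric.closedBall_mem_nhds (c • one m) c_pos,
    (isOpen_lt (f := fun X => inner ℝ (one m) X) (by fun_prop) continuous_const).mem_nhds trace_lt]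
    with X hX trace_X
  refine ⟨?_, le_of_lt trace_X⟩
  rw [mem_closedBall_iff_norm] at hX
  exact add_sub_cancel (c • one m) X ▸ posSemidef_smul_one_add hX

theorem uniqueDiffOn_budgetSet {a : ℝ} (ha : 0 < a) : UniqueDiffOn ℝ (budgetSet m a) :=
  uniqueDiffOn_convex (convex_budgetSet a) (interior_budgetSet_nonempty ha)

theorem expProj_mem_budgetSet {a : ℝ} (ha : 0 ≤ a) (Y : Herm m) : expProj a Y ∈ budgetSet m a := by
  rw [budgetSet_eq, expProj_eq]
  refine ⟨Matrix.PosSemidef.smul (posSemidef_exp _) ha, ?_⟩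
  rw [mem_ofPred_eq, inner_smul_right, inner_one_exp_normalized]
  exact mul_le_of_le_one_right ha (sub_le_self _ (Real.exp_pos _).le)

theorem norm_expProj_sub_le {a : ℝ} (ha : 0 ≤ a) (X Y : Herm m) :
    ‖expProj a X - expProj a Y‖ ≤ a * (1 + ‖one m‖) * ‖X - Y‖ := by
  rw [expProj_eq, expProj_eq, ← smul_sub, norm_smul, Real.norm_of_nonneg ha, mul_assoc]
  exact mul_le_mul_of_nonneg_left (norm_exp_normalized_sub_le X Y) ha

theorem continuous_expProj (a : ℝ) : Continuous (expProj (m := m) a) := by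
  simp only [funext (expProj_eq a)]
  refine (LipschitzWith.of_dist_le' (K := 1 + ‖one m‖) fun X Y => ?_).continuous.const_smul a
  simpa only [dist_eq_norm] using norm_exp_normalized_sub_le X Y

theorem toMatrix_ofMatrix (A : Matrix (Fin m) (Fin m) ℂ) :
    (ofMatrix A).toMatrix = (1 / 2 : ℝ) • (A + Aᴴ) := rfl

theorem ofMatrix_toMatrix_add (V : Herm m) (A : Matrix (Fin m) (Fin m) ℂ) :
    ofMatrix (V.toMatrix + A) = V + ofMatrix A := by
  apply toMatrix_injective
  rw [toMatrix_add, toMatrix_ofMatrix, toMatrix_ofMatrix, Matrix.conjTranspose_add,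
    V.isHermitian.eq, add_add_add_comm, smul_add, ← two_smul ℝ V.toMatrix, smul_smul,
    one_div, inv_mul_cancel₀ two_ne_zero, one_smul]

/-- The Hermitian part as a linear map. -/
def ofMatrixₗ (m : ℕ) : Matrix (Fin m) (Fin m) ℂ →ₗ[ℝ] Herm m where
  toFun := ofMatrix
  map_add' A B := by
    apply toMatrix_injective
    rw [toMatrix_add, toMatrix_ofMatrix, toMatrix_ofMatrix, toMatrix_ofMatrix,
      Matrix.conjTranspose_add, add_add_add_comm, smul_add]
  map_smul' r A := by
    apply toMatrix_injective
    rw [toMatrix_smul, toMatrix_ofMatrix, toMatrix_ofMatrix, Matrix.conjTranspose_smul,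
      star_trivial, ← smul_add, RingHom.id_apply, smul_comm r]

end Herm

theorem exists_norm_le_mul_singularNorm {m : ℕ} {F : Type*} [NormedAddCommGroup F]
    [NormedSpace ℝ F] (L : Matrix (Fin m) (Fin m) ℂ →ₗ[ℝ] F) :
    ∃ C, 0 ≤ C ∧ ∀ A, ‖L A‖ ≤ C * singularNorm A := by
  let e := (Matrix.toEuclideanCLM (n := Fin m) (𝕜 := ℂ)).toAlgEquiv.toLinearEquiv.restrictScalars ℝ
  have := e.finiteDimensional
  let T := (L ∘ₗ e.symm.toLinearMap).toContinuousLinearMap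
  have T_apply (A) : T (e A) = L A := congrArg L (e.symm_apply_apply A)
  exact ⟨‖T‖, norm_nonneg T, fun A => T_apply A ▸ T.le_opNorm (e A)⟩

section VariationalInequality

variable {E : Type*} [AddCommGroup E] [Module ℝ E] [TopologicalSpace E] [IsTopologicalAddGroup E]
  [ContinuousSMul ℝ E] {K : Set E}

theorem sum_mul_sum_mul_nonpos {κ : Type*} [Fintype κ] {w : κ → ℝ} {c : κ → κ → ℝ}
    (hw : ∀ k, 0 ≤ w k) (hc : ∀ k l, c k l + c l k ≤ 0) :
    ∑ k, w k * ∑ l, w l * c k l ≤ 0 := by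
  have double_sum : ∑ k, w k * ∑ l, w l * c k l + ∑ k, w k * ∑ l, w l * c k l =
      ∑ k, ∑ l, w k * w l * (c k l + c l k) := by
    simp only [Finset.mul_sum]
    conv_lhs => enter [2]; rw [Finset.sum_comm]
    simp only [← Finset.sum_add_distrib]
    exact Finset.sum_congr rfl fun k _ => Finset.sum_congr rfl fun l _ => by ring
  have double_nonpos : ∑ k, ∑ l, w k * w l * (c k l + c l k) ≤ 0 :=
    Finset.sum_nonpos fun k _ => Finset.sum_nonpos fun l _ =>
      mul_nonpos_of_nonneg_of_nonpos (mul_nonneg (hw k) (hw l)) (hc k l)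
  linarith

/-- A saddle point `(x, q)` of `∑ q_k W_k (y_k - x)` on `K ×` simplex gives the bound: testing it
against the barycentre `∑ q_k y_k` produces a sum that is nonpositive by monotonicity. -/
theorem exists_forall_apply_sub_nonpos_of_finite {κ : Type*} [Finite κ] (hK : IsCompact K)
    (hconv : Convex ℝ K) (hne : K.Nonempty) {W : κ → E →L[ℝ] ℝ} {y : κ → E} (hy : ∀ k, y k ∈ K)
    (hmono : ∀ k l, W k (y k - y l) ≤ W l (y k - y l)) :
    ∃ x ∈ K, ∀ k, W k (y k - x) ≤ 0 := by
  classical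
  have := Fintype.ofFinite κ
  rcases isEmpty_or_nonempty κ with hκ | ⟨⟨k₀⟩⟩
  · exact ⟨hne.some, hne.some_mem, isEmptyElim⟩
  let f : E → (κ → ℝ) → ℝ := fun x q => ∑ k, q k * W k (y k - x)
  have f_left (q : κ → ℝ) : ConvexOn ℝ K fun x => f x q := by
    have := (convexOn_const (∑ k, q k * W k (y k)) hconv).sub
      ((∑ k, q k • W k : E →L[ℝ] ℝ).toLinearMap.concaveOn hconv)
    refine this.congr fun x _ => ?_
    simp [f, mul_sub, Finset.sum_sub_distrib]
  have f_right (x : E) : ConcaveOn ℝ (stdSimplex ℝ κ) (f x) :=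
    (Fintype.linearCombination ℝ fun k => W k (y k - x)).concaveOn (convex_stdSimplex ℝ κ)
  obtain ⟨x, hx, q, hq, saddle⟩ := Sion.exists_isSaddlePointOn (f := f) hne hconv hK
    (fun q _ => (Continuous.lowerSemicontinuous (by fun_prop)).lowerSemicontinuousOn K)
    (fun q _ => (f_left q).quasiconvexOn) (convex_stdSimplex ℝ κ)
    ⟨_, single_mem_stdSimplex ℝ k₀⟩ (isCompact_stdSimplex ℝ κ)
    (fun x _ => (Continuous.upperSemicontinuous (by fun_prop)).upperSemicontinuousOn _)
    (fun x _ => (f_right x).quasiconcaveOn)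
  refine ⟨x, hx, fun k => ?_⟩
  calc W k (y k - x) = f x (Pi.single k 1) := by
        simp [f, Pi.single_apply]
    _ ≤ f (∑ l, q l • y l) q :=
        saddle _ (hconv.sum_mem (fun l _ => hq.1 l) hq.2 fun l _ => hy l) _
          (single_mem_stdSimplex ℝ k)
    _ = ∑ k, q k * ∑ l, q l * W k (y k - y l) := by
        refine Finset.sum_congr rfl fun k _ => congrArg (q k * ·) ?_
        rw [show y k - ∑ l, q l • y l = ∑ l, q l • (y k - y l) by
          simp_rw [smul_sub]; rw [Finset.sum_sub_distrib, ← Finset.sum_smul, hq.2, one_smul]]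
        simp only [map_sum, map_smul, smul_eq_mul]
    _ ≤ 0 := sum_mul_sum_mul_nonpos hq.1 fun k l => by
        rw [← neg_sub (y k) (y l), map_neg]
        linarith [hmono k l]

theorem exists_forall_apply_sub_nonpos_of_monotone (hK : IsCompact K) (hconv : Convex ℝ K)
    (hne : K.Nonempty) {V : E → E →L[ℝ] ℝ}
    (hmono : ∀ x ∈ K, ∀ y ∈ K, V y (y - x) ≤ V x (y - x)) :
    ∃ x ∈ K, ∀ y ∈ K, V y (y - x) ≤ 0 := by
  obtain ⟨x, hx, solution⟩ := hK.inter_iInter_nonempty (fun y : K => {x | V y (y - x) ≤ 0})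
    (fun y => isClosed_le (by fun_prop) continuous_const) fun s => by
      obtain ⟨x, hx, h⟩ := exists_forall_apply_sub_nonpos_of_finite hK hconv hne
        (fun y : s => y.1.2) (fun y z : s => hmono z.1 z.1.2 y.1 y.1.2)
      exact ⟨x, hx, mem_iInter₂.2 fun y hy => h ⟨y, hy⟩⟩
  exact ⟨x, hx, fun y hy => mem_iInter.1 solution ⟨y, hy⟩⟩

/-- Minty's lemma: divide the inequality at the points `x + t (y - x)` by `t` and let `t → 0`. -/
theorem apply_sub_nonpos_of_forall_apply_sub_nonpos (hconv : Convex ℝ K) {V : E → E →L[ℝ] ℝ}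
    (hV : ∀ h, ContinuousOn (fun x => V x h) K) {x : E} (hx : x ∈ K)
    (h : ∀ y ∈ K, V y (y - x) ≤ 0) {y : E} (hy : y ∈ K) : V x (y - x) ≤ 0 := by
  have segment_mem (t : ℝ) (ht : t ∈ Icc (0 : ℝ) 1) : x + t • (y - x) ∈ K :=
    hconv.add_smul_sub_mem hx hy ht
  have cont : ContinuousOn (fun t : ℝ => V (x + t • (y - x)) (y - x)) (Icc 0 1) :=
    (hV (y - x)).comp (by fun_prop) segment_mem
  have lim := (cont 0 (by simp)).mono_left
    (nhdsWithin_mono 0 (Ioc_subset_Icc_self (a := (0 : ℝ)) (b := 1)))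
  simp only [zero_smul, add_zero] at lim
  rw [nhdsWithin_Ioc_eq_nhdsGT zero_lt_one] at lim
  refine le_of_tendsto lim ?_
  filter_upwards [Ioc_mem_nhdsGT zero_lt_one] with t ht
  have nonpos := h _ (segment_mem t (Ioc_subset_Icc_self ht))
  rw [add_sub_cancel_left, map_smul, smul_eq_mul] at nonpos
  exact nonpos_of_mul_nonpos_right nonpos ht.1

theorem exists_variational_solution (hK : IsCompact K) (hconv : Convex ℝ K) (hne : K.Nonempty)
    {V : E → E →L[ℝ] ℝ} (hV : ∀ h, ContinuousOn (fun x => V x h) K)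
    (hmono : ∀ x ∈ K, ∀ y ∈ K, V y (y - x) ≤ V x (y - x)) :
    ∃ x ∈ K, ∀ y ∈ K, V x (y - x) ≤ 0 := by
  obtain ⟨x, hx, h⟩ := exists_forall_apply_sub_nonpos_of_monotone hK hconv hne hmono
  exact ⟨x, hx, fun y hy => apply_sub_nonpos_of_forall_apply_sub_nonpos hconv hV hx h hy⟩

end VariationalInequality

section Derivative

variable {E : Type*} [NormedAddCommGroup E] [NormedSpace ℝ E] {s : Set E} {x y : E}

theorem hasDerivWithinAt_comp_lineMap {F : Type*} [NormedAddCommGroup F] [NormedSpace ℝ F]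
    {f : E → F} {f' : E →L[ℝ] F} {t : ℝ} (hs : Convex ℝ s) (hx : x ∈ s) (hy : y ∈ s)
    (hf : HasFDerivWithinAt f f' s (AffineMap.lineMap x y t)) :
    HasDerivWithinAt (fun r : ℝ => f (AffineMap.lineMap x y r)) (f' (y - x)) (Icc 0 1) t :=
  hf.comp_hasDerivWithinAt t AffineMap.hasDerivWithinAt_lineMap
    fun _ hr => hs.lineMap_mem hx hy hr

theorem sub_le_of_concaveOn_of_hasFDerivWithinAt {f : E → ℝ} {f' : E →L[ℝ] ℝ}
    (hf : ConcaveOn ℝ s f) (hx : x ∈ s) (hy : y ∈ s) (hf' : HasFDerivWithinAt f f' s x) :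
    f y - f x ≤ f' (y - x) := by
  have concave_segment : ConcaveOn ℝ (Icc (0 : ℝ) 1) (f ∘ AffineMap.lineMap x y) :=
    (hf.comp_affineMap (AffineMap.lineMap x y)).subset
      (fun t ht => hf.1.lineMap_mem hx hy ht) (convex_Icc 0 1)
  have deriv_segment := hasDerivWithinAt_comp_lineMap (t := 0) hf.1 hx hy
    (by rwa [AffineMap.lineMap_apply_zero])
  simpa [slope_def_field] using
    concave_segment.slope_le_of_hasDerivWithinAt (by simp) (by simp) zero_lt_one deriv_segment

theorem apply_sub_lt_apply_sub_of_hasFDerivWithinAt_neg {V : E → E →L[ℝ] ℝ}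
    {V' : E → E →L[ℝ] E →L[ℝ] ℝ} (hs : Convex ℝ s)
    (hV : ∀ z ∈ s, HasFDerivWithinAt V (V' z) s z) (hV' : ∀ z ∈ s, ∀ h ≠ 0, V' z h h < 0)
    (hx : x ∈ s) (hy : y ∈ s) (hxy : x ≠ y) : V y (y - x) < V x (y - x) := by
  have deriv_segment (t : ℝ) (ht : t ∈ Icc (0 : ℝ) 1) :
      HasDerivWithinAt (fun r : ℝ => V (AffineMap.lineMap x y r) (y - x))
        (V' (AffineMap.lineMap x y t) (y - x) (y - x)) (Icc 0 1) t := by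
    simpa using (hasDerivWithinAt_comp_lineMap hs hx hy
      (hV _ (hs.lineMap_mem hx hy ht))).clm_apply (hasDerivWithinAt_const t _ (y - x))
  have strict_anti := strictAntiOn_of_hasDerivWithinAt_neg (convex_Icc (0 : ℝ) 1)
    (fun t ht => (deriv_segment t ht).continuousWithinAt)
    (fun t ht => (deriv_segment t (interior_subset ht)).mono interior_subset)
    fun t ht => hV' _ (hs.lineMap_mem hx hy (interior_subset ht)) _ (sub_ne_zero.2 hxy.symm)
  simpa using strict_anti (by simp) (by simp) zero_lt_one

end Derivative

/-- If the sequence enters the `δ`-ball around `p` late enough, it cannot leave the `3δ`-ball: one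
step out of the `δ`-ball has length at most `δ`, and the steps outside it have total length at
most `δ`. Since `γ` is not summable, it does enter. -/
theorem tendsto_of_summable_indicator {E : Type*} [PseudoMetricSpace E] {x : ℕ → E} {p : E}
    {γ : ℕ → ℝ} (hγ : ¬ Summable γ)
    (hx : Tendsto (fun n => dist (x n) (x (n + 1))) atTop (𝓝 0))
    (hγ_far : ∀ δ > 0, Summable ({n | δ ≤ dist (x n) p}.indicator γ))
    (hx_far : ∀ δ > 0, Summable ({n | δ ≤ dist (x n) p}.indicator
      fun n => dist (x n) (x (n + 1)))) :
    Tendsto x atTop (𝓝 p) := by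
  refine Metric.tendsto_atTop'.2 fun ε hε => ?_
  obtain ⟨δ, hδ, rfl⟩ : ∃ δ > 0, 3 * δ = ε := ⟨ε / 3, by positivity, by ring⟩
  set a := {n | δ ≤ dist (x n) p}.indicator fun n => dist (x n) (x (n + 1))
  have a_nonneg (n) : 0 ≤ a n := indicator_nonneg (fun _ _ => dist_nonneg) n
  have small_step : ∀ᶠ n in atTop, dist (x n) (x (n + 1)) < δ := hx.eventually_lt_const hδ
  have small_tail : ∀ᶠ n in atTop, ∑' k, a (k + n) < δ :=
    (tendsto_sum_nat_add a).eventually_lt_const hδ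
  have close : ∃ᶠ n in atTop, dist (x n) p < δ := fun far => hγ <|
    (hγ_far δ hδ).congr_atTop <| far.mono fun n hn =>
      indicator_of_mem (s := {n | δ ≤ dist (x n) p}) (not_lt.1 hn) γ
  obtain ⟨N, dist_N, tail_N, step_N⟩ :=
    (close.and_eventually (small_tail.and (eventually_forall_ge_atTop.2 small_step))).exists
  have partial_sum (n : ℕ) : dist (x (N + n)) p ≤ 2 * δ + ∑ k ∈ Finset.range n, a (k + N) := by
    induction n with
    | zero => simpa using dist_N.le.trans (by linarith)
    | succ n ih =>
      have triangle := dist_triangle_left (x (N + n + 1)) p (x (N + n))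
      rw [← add_assoc]
      rcases lt_or_ge (dist (x (N + n)) p) δ with near | far
      · have sum_nonneg : 0 ≤ ∑ k ∈ Finset.range (n + 1), a (k + N) :=
          Finset.sum_nonneg fun k _ => a_nonneg (k + N)
        linarith [step_N (N + n) (Nat.le_add_right N n)]
      · have a_eq : a (n + N) = dist (x (N + n)) (x (N + n + 1)) := by
          rw [add_comm n N]
          exact indicator_of_mem (s := {n | δ ≤ dist (x n) p}) far _
        rw [Finset.sum_range_succ]
        linarith
  refine ⟨N, fun n hn => ?_⟩
  obtain ⟨k, rfl⟩ := Nat.exists_eq_add_of_lt hn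
  have sum_le := ((summable_nat_add_iff N).2 (hx_far δ hδ)).sum_le_tsum
    (Finset.range (k + 1)) fun k _ => a_nonneg (k + N)
  have bound := partial_sum (k + 1)
  rw [← add_assoc] at bound
  linarith

section Expectation

variable {Ω : Type*} {m mΩ : MeasurableSpace Ω} {μ : Measure Ω}

theorem measurable_comp_of_continuousOn {E F : Type*} [TopologicalSpace E] [MeasurableSpace E]
    [OpensMeasurableSpace E] [TopologicalSpace F] [MeasurableSpace F] [BorelSpace F] {s : Set E}
    {f : E → F} {g : Ω → E} (hf : ContinuousOn f s) (hg : Measurable g) (hgs : ∀ ω, g ω ∈ s) :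
    Measurable fun ω => f (g ω) :=
  hf.domRestrict.measurable.comp (hg.subtype_mk (h := hgs))

theorem integral_bilin_eq_zero_of_condExp_eq_zero [IsFiniteMeasure μ] (hm : m ≤ mΩ)
    {E F H : Type*} [NormedAddCommGroup E] [NormedSpace ℝ E] [CompleteSpace E]
    [NormedAddCommGroup F] [NormedSpace ℝ F] [NormedAddCommGroup H] [NormedSpace ℝ H]
    [CompleteSpace H] (B : F →L[ℝ] E →L[ℝ] H) {f : Ω → F} {g : Ω → E}
    (hf : StronglyMeasurable[m] f) (hfg : Integrable (fun ω => B (f ω) (g ω)) μ)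
    (hg : Integrable g μ) (hg_zero : μ[g | m] =ᵐ[μ] 0) : ∫ ω, B (f ω) (g ω) ∂μ = 0 := by
  rw [← integral_condExp hm]
  refine integral_eq_zero_of_ae ?_
  filter_upwards [condExp_bilin_of_stronglyMeasurable_left B hf hfg hg, hg_zero] with ω h h_zero
  rw [h, h_zero, Pi.zero_apply, map_zero]
  rfl

theorem integral_mul_le_of_condExp_le [IsFiniteMeasure μ] (hm : m ≤ mΩ) {f g : Ω → ℝ} {c : ℝ}
    (hf : StronglyMeasurable[m] f) (hf_nonneg : ∀ ω, 0 ≤ f ω) (hf_int : Integrable f μ)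
    (hfg : Integrable (fun ω => f ω * g ω) μ) (hg : Integrable g μ)
    (hg_le : μ[g | m] ≤ᵐ[μ] fun _ => c) : ∫ ω, f ω * g ω ∂μ ≤ c * ∫ ω, f ω ∂μ := by
  rw [← integral_condExp hm, ← integral_const_mul]
  refine integral_mono_ae integrable_condExp (hf_int.const_mul c) ?_
  filter_upwards [condExp_mul_of_stronglyMeasurable_left hf hfg hg, hg_le] with ω h h_le
  refine h.trans_le ?_
  rw [mul_comm c]
  exact mul_le_mul_of_nonneg_left h_le (hf_nonneg ω)

theorem condExp_sum_clm_eq_zero {κ E F : Type*} [Fintype κ] [NormedAddCommGroup E]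
    [NormedSpace ℝ E] [CompleteSpace E] [NormedAddCommGroup F] [NormedSpace ℝ F] [CompleteSpace F]
    {g : κ → Ω → E} (hg : ∀ k, Integrable (g k) μ) (hg_zero : ∀ k, μ[g k | m] =ᵐ[μ] 0)
    (T : κ → E →L[ℝ] F) : μ[fun ω => ∑ k, T k (g k ω) | m] =ᵐ[μ] 0 := by
  have sum_eq : (fun ω => ∑ k, T k (g k ω)) = ∑ k, T k ∘ g k := by ext; simp
  have term_int (k : κ) : Integrable (T k ∘ g k) μ := (T k).integrable_comp (hg k)
  have term_zero (k : κ) : μ[T k ∘ g k | m] =ᵐ[μ] 0 := by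
    filter_upwards [(T k).comp_condExp_comm (hg k), hg_zero k] with ω h h_zero
    rw [← h, Function.comp_apply, h_zero, Pi.zero_apply, map_zero, Pi.zero_apply]
  rw [sum_eq]
  filter_upwards [condExp_finsetSum (s := Finset.univ) (fun k _ => term_int k) m,
    ae_all_iff.2 term_zero] with ω h h_zero
  rw [h, Finset.sum_apply]
  exact Finset.sum_eq_zero fun k _ => h_zero k

theorem ae_summable_of_summable_integral {f : ℕ → Ω → ℝ} (hf : ∀ n, Integrable (f n) μ)
    (hf_nonneg : ∀ n ω, 0 ≤ f n ω) (h : Summable fun n => ∫ ω, f n ω ∂μ) :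
    ∀ᵐ ω ∂μ, Summable fun n => f n ω := by
  have norm_eq (n : ℕ) (ω : Ω) : ‖f n ω‖ = f n ω := Real.norm_of_nonneg (hf_nonneg n ω)
  have eLpNorm_eq (n : ℕ) : eLpNorm (f n) 1 μ = ENNReal.ofReal (∫ ω, f n ω ∂μ) := by
    rw [eLpNorm_one_eq_lintegral_enorm, ← ofReal_integral_norm_eq_lintegral_enorm (hf n)]
    simp only [norm_eq]
  have ae_summable := summable_norm_of_tsum_eLpNorm_ne_top le_rfl
    (fun n => (hf n).aestronglyMeasurable) (by simpa only [eLpNorm_eq] using h.tsum_ofReal_ne_top)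
  simpa only [norm_eq] using ae_summable

/-- A Lyapunov argument in expectation: sum the inequalities, so that `e` telescopes, and
integrate. -/
theorem summable_integral_of_add_le_add {e g r : ℕ → Ω → ℝ} (he : ∀ n ω, 0 ≤ e n ω)
    (he_int : Integrable (e 0) μ) (hg : ∀ n ω, 0 ≤ g n ω) (hg_int : ∀ n, Integrable (g n) μ)
    (hr_int : ∀ n, Integrable (r n) μ) (hr : Summable fun n => ∫ ω, r n ω ∂μ)
    (h : ∀ n ω, e (n + 1) ω + g n ω ≤ e n ω + r n ω) : Summable fun n => ∫ ω, g n ω ∂μ := by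
  have telescope (N : ℕ) (ω : Ω) :
      e N ω + ∑ n ∈ Finset.range N, g n ω ≤ e 0 ω + ∑ n ∈ Finset.range N, r n ω := by
    induction N with
    | zero => simp
    | succ N ih =>
      rw [Finset.sum_range_succ, Finset.sum_range_succ]
      linarith [h N ω]
  obtain ⟨C, hC⟩ := hr.hasSum.tendsto_sum_nat.bddAbove_range
  refine summable_of_sum_range_le (c := ∫ ω, e 0 ω ∂μ + C)
    (fun n => integral_nonneg (hg n)) fun N => ?_
  have hr_sum : Integrable (fun ω => ∑ n ∈ Finset.range N, r n ω) μ :=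
    integrable_finsetSum _ fun n _ => hr_int n
  calc ∑ n ∈ Finset.range N, ∫ ω, g n ω ∂μ = ∫ ω, ∑ n ∈ Finset.range N, g n ω ∂μ :=
        (integral_finsetSum _ fun n _ => hg_int n).symm
    _ ≤ ∫ ω, (e 0 ω + ∑ n ∈ Finset.range N, r n ω) ∂μ :=
        integral_mono (integrable_finsetSum _ fun n _ => hg_int n) (he_int.add hr_sum)
          fun ω => by linarith [he N ω, telescope N ω]
    _ = ∫ ω, e 0 ω ∂μ + ∑ n ∈ Finset.range N, ∫ ω, r n ω ∂μ := by
        rw [integral_add he_int hr_sum, integral_finsetSum _ fun n _ => hr_int n]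
    _ ≤ ∫ ω, e 0 ω ∂μ + C := add_le_add_right (hC ⟨N, rfl⟩) _

end Expectation

namespace MatrixGame

variable {ι : Type*} (G : MatrixGame ι)

theorem feasible_eq_pi : G.feasible = univ.pi G.actions := Set.ext fun _ => mem_univ_pi.symm

theorem convex_actions (i : ι) : Convex ℝ (G.actions i) := Herm.convex_budgetSet (G.A i)

theorem convex_feasible : Convex ℝ G.feasible := by
  rw [feasible_eq_pi]
  exact convex_pi fun i _ => G.convex_actions i

theorem isCompact_feasible : IsCompact G.feasible := by
  rw [feasible_eq_pi]
  exact isCompact_univ_pi fun i => Herm.isCompact_budgetSet (G.A i)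

theorem feasible_nonempty : G.feasible.Nonempty :=
  ⟨0, fun i => Herm.zero_mem_budgetSet (G.A_pos i).le⟩

theorem choice_mem_feasible (Y : G.Profile) : G.choice Y ∈ G.feasible := fun i =>
  Herm.expProj_mem_budgetSet (G.A_pos i).le (Y i)

theorem update_mem_feasible [DecidableEq ι] {X : G.Profile} (hX : X ∈ G.feasible) {i : ι}
    {Y : Herm (G.M i)} (hY : Y ∈ G.actions i) : Function.update X i Y ∈ G.feasible := by
  intro j
  obtain rfl | h := eq_or_ne j i
  · rwa [Function.update_self]
  · rw [Function.update_of_ne h]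
    exact hX j

/-- The profile `V(X)` of the individual payoff gradients. -/
def gradProfile [DecidableEq ι] (X : G.Profile) : G.Profile := fun i => G.grad i X

variable [Fintype ι]

/-- The inner product `∑ i, ⟪X i, Y i⟫` of profiles. It is not an `inner`, since `Profile` carries
the maximum norm. -/
def pairing : G.Profile →L[ℝ] G.Profile →L[ℝ] ℝ :=
  ∑ i, (innerSL ℝ).bilinearComp (ContinuousLinearMap.proj i) (ContinuousLinearMap.proj i)

variable {G}

theorem pairing_apply (X Y : G.Profile) : G.pairing X Y = ∑ i, inner ℝ (X i) (Y i) := by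
  simp [pairing, sum_apply]

section Equilibrium

variable [DecidableEq ι]

theorem IndividuallySmooth.hasFDerivWithinAt_payoff (hsmooth : G.IndividuallySmooth)
    {X : G.Profile} (hX : X ∈ G.feasible) (i : ι) :
    HasFDerivWithinAt (fun Y => G.u i (Function.update X i Y)) (innerSL ℝ (G.grad i X))
      (G.actions i) (X i) :=
  (hsmooth.1 i X hX).hasGradientWithinAt.hasFDerivWithinAt

theorem IndividuallySmooth.contDiffOn_gradProfile (hsmooth : G.IndividuallySmooth) :
    ContDiffOn ℝ 1 G.gradProfile G.feasible :=
  contDiffOn_pi.2 hsmooth.2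

theorem IndividuallySmooth.hasFDerivWithinAt_gradProfile (hsmooth : G.IndividuallySmooth)
    {X : G.Profile} (hX : X ∈ G.feasible) : HasFDerivWithinAt G.gradProfile
      (fderivWithin ℝ G.gradProfile G.feasible X) G.feasible X :=
  (hsmooth.contDiffOn_gradProfile.differentiableOn one_ne_zero X hX).hasFDerivWithinAt

theorem isNash_of_pairing_nonpos (hconc : G.IndividuallyConcave) (hsmooth : G.IndividuallySmooth)
    {X : G.Profile} (hX : X ∈ G.feasible)
    (h : ∀ Y ∈ G.feasible, G.pairing (G.gradProfile X) (Y - X) ≤ 0) : G.IsNash X := by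
  refine ⟨hX, fun i Y hY => ?_⟩
  have first_order := sub_le_of_concaveOn_of_hasFDerivWithinAt (hconc i X hX) (hX i) hY
    (hsmooth.hasFDerivWithinAt_payoff hX i)
  have unilateral : G.pairing (G.gradProfile X) (Function.update X i Y - X) =
      inner ℝ (G.grad i X) (Y - X i) := by
    rw [pairing_apply, Finset.sum_eq_single_of_mem i (Finset.mem_univ i)]
    · rw [Pi.sub_apply, Function.update_self, gradProfile]
    · intro j _ hj
      rw [Pi.sub_apply, Function.update_of_ne hj, sub_self, inner_zero_right]
  have nonpos := h _ (G.update_mem_feasible hX hY)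
  rw [Function.update_eq_self, innerSL_apply_apply] at first_order
  linarith

theorem IsNash.pairing_nonpos (hsmooth : G.IndividuallySmooth) {X Y : G.Profile} (hX : G.IsNash X)
    (hY : Y ∈ G.feasible) : G.pairing (G.gradProfile X) (Y - X) ≤ 0 := by
  rw [pairing_apply]
  refine Finset.sum_nonpos fun i _ => ?_
  have isMaxOn : IsMaxOn (fun Y => G.u i (Function.update X i Y)) (G.actions i) (X i) :=
    fun Y hY => by simpa using hX.2 i Y hY
  exact isMaxOn.localize.hasFDerivWithinAt_nonpos (hsmooth.hasFDerivWithinAt_payoff hX.1 i)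
    (sub_mem_posTangentConeAt_of_segment_subset
      ((G.convex_actions i).segment_subset (hX.1 i) (hY i)))

theorem IndividuallySmooth.gradDeriv_apply (hsmooth : G.IndividuallySmooth) {X : G.Profile}
    (hX : X ∈ G.feasible) (i j : ι) (H : Herm (G.M j)) :
    G.gradDeriv i j X H = fderivWithin ℝ G.gradProfile G.feasible X (Pi.single j H) i := by
  have deriv_at_update : HasFDerivWithinAt G.gradProfile
      (fderivWithin ℝ G.gradProfile G.feasible X) G.feasible (Function.update X j (X j)) := by
    rw [Function.update_eq_self]
    exact hsmooth.hasFDerivWithinAt_gradProfile hX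
  have deriv_comp := hasFDerivWithinAt_pi'.1 (deriv_at_update.comp (X j)
    (hasFDerivAt_update (𝕜 := ℝ) X (X j)).hasFDerivWithinAt
    fun Y hY => G.update_mem_feasible hX hY) i
  rw [gradDeriv, show fderivWithin ℝ (fun Y => G.grad i (Function.update X j Y)) _ _ = _ from
    deriv_comp.fderivWithin (Herm.uniqueDiffOn_budgetSet (G.A_pos j) _ (hX j))]
  refine congrArg (fun K => fderivWithin ℝ G.gradProfile G.feasible X K i) (funext fun k => ?_)
  obtain rfl | hk := eq_or_ne k j <;> simp [*]

theorem IndividuallySmooth.sum_inner_hessianBlock (hsmooth : G.IndividuallySmooth)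
    {X : G.Profile} (hX : X ∈ G.feasible) (H : G.Profile) :
    ∑ i, ∑ j, inner ℝ (H i) (G.hessianBlock i j X (H j)) =
      G.pairing (fderivWithin ℝ G.gradProfile G.feasible X H) H := by
  have block (i j : ι) : inner ℝ (H i) (G.hessianBlock i j X (H j)) =
      1 / 2 * inner ℝ (H j) (G.gradDeriv j i X (H i)) +
        1 / 2 * inner ℝ (H i) (G.gradDeriv i j X (H j)) := by
    rw [hessianBlock, add_apply, smul_apply, smul_apply, inner_add_right, inner_smul_right,
      inner_smul_right, ContinuousLinearMap.adjoint_inner_right, real_inner_comm]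
  have row (i : ι) : ∑ j, inner ℝ (H i) (G.gradDeriv i j X (H j)) =
      inner ℝ (fderivWithin ℝ G.gradProfile G.feasible X H i) (H i) := by
    simp only [hsmooth.gradDeriv_apply hX]
    rw [← inner_sum, ← Finset.sum_apply, ← map_sum, Finset.univ_sum_single, real_inner_comm]
  simp only [block, Finset.sum_add_distrib, ← Finset.mul_sum]
  rw [Finset.sum_comm, ← add_mul, add_halves, one_mul, pairing_apply]
  exact Finset.sum_congr rfl fun i _ => row i

theorem IndividuallySmooth.pairing_sub_lt_pairing_sub (hsmooth : G.IndividuallySmooth)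
    (hD : ∀ X ∈ G.feasible, G.HessianNegDef X) {X Y : G.Profile} (hX : X ∈ G.feasible)
    (hY : Y ∈ G.feasible) (hXY : X ≠ Y) :
    G.pairing (G.gradProfile Y) (Y - X) < G.pairing (G.gradProfile X) (Y - X) :=
  apply_sub_lt_apply_sub_of_hasFDerivWithinAt_neg G.convex_feasible
    (V := fun X => G.pairing (G.gradProfile X))
    (fun Z hZ => G.pairing.hasFDerivAt.comp_hasFDerivWithinAt Z
      (hsmooth.hasFDerivWithinAt_gradProfile hZ))
    (fun Z hZ H hH => (hsmooth.sum_inner_hessianBlock hZ H).symm.trans_lt (hD Z hZ H hH))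
    hX hY hXY

theorem exists_isNash (hconc : G.IndividuallyConcave) (hsmooth : G.IndividuallySmooth)
    (hD : ∀ X ∈ G.feasible, G.HessianNegDef X) : ∃ X, G.IsNash X := by
  obtain ⟨X, hX, solution⟩ := exists_variational_solution G.isCompact_feasible G.convex_feasible
    G.feasible_nonempty (V := fun X => G.pairing (G.gradProfile X))
    (fun H => (G.pairing.flip H).continuous.comp_continuousOn
      hsmooth.contDiffOn_gradProfile.continuousOn) fun X hX Y hY => by
      obtain rfl | hXY := eq_or_ne X Y
      · exact le_rfl
      · exact (hsmooth.pairing_sub_lt_pairing_sub hD hX hY hXY).le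
  exact ⟨X, isNash_of_pairing_nonpos hconc hsmooth hX solution⟩

variable (G) in
/-- The duality gap `⟪V(X), X* - X⟫`: the rate at which the payoff gradient at `X` pushes towards
`X*`. -/
def gap (Xs X : G.Profile) : ℝ := G.pairing (G.gradProfile X) (Xs - X)

variable (G) in
/-- Global variational stability: away from `X*` the payoff gradient always points towards `X*`. -/
def IsGloballyStable (Xs : G.Profile) : Prop :=
  Xs ∈ G.feasible ∧ ∀ X ∈ G.feasible, X ≠ Xs → 0 < G.gap Xs X

theorem IsNash.isGloballyStable (hsmooth : G.IndividuallySmooth)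
    (hD : ∀ X ∈ G.feasible, G.HessianNegDef X) {Xs : G.Profile} (hXs : G.IsNash Xs) :
    G.IsGloballyStable Xs := by
  refine ⟨hXs.1, fun X hX hne => ?_⟩
  have neg := (hsmooth.pairing_sub_lt_pairing_sub hD hXs.1 hX hne.symm).trans_le
    (hXs.pairing_nonpos hsmooth hX)
  rwa [gap, ← neg_sub, map_neg, neg_pos]

theorem IsGloballyStable.eq_of_isNash (hsmooth : G.IndividuallySmooth) {Xs X : G.Profile}
    (hXs : G.IsGloballyStable Xs) (hX : G.IsNash X) : X = Xs :=
  of_not_not fun hne => (hXs.2 X hX.1 hne).not_ge (hX.pairing_nonpos hsmooth hXs.1)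

theorem IsGloballyStable.gap_nonneg {Xs X : G.Profile} (hXs : G.IsGloballyStable Xs)
    (hX : X ∈ G.feasible) : 0 ≤ G.gap Xs X := by
  obtain rfl | hne := eq_or_ne X Xs
  · rw [gap, sub_self, map_zero]
  · exact (hXs.2 X hX hne).le

theorem continuousOn_gap (hV : ContinuousOn G.gradProfile G.feasible) (Xs : G.Profile) :
    ContinuousOn (G.gap Xs) G.feasible :=
  (G.pairing.continuous.comp_continuousOn hV).clm_apply (by fun_prop)

theorem IsGloballyStable.exists_le_gap (hV : ContinuousOn G.gradProfile G.feasible)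
    {Xs : G.Profile} (hXs : G.IsGloballyStable Xs) {δ : ℝ} (hδ : 0 < δ) :
    ∃ c > 0, ∀ X ∈ G.feasible, δ ≤ dist X Xs → c ≤ G.gap Xs X := by
  have compact : IsCompact (G.feasible ∩ {X | δ ≤ dist X Xs}) :=
    G.isCompact_feasible.inter_right (isClosed_le continuous_const (by fun_prop))
  obtain ⟨c, c_pos, hc⟩ := compact.exists_forall_le'
    ((continuousOn_gap hV Xs).mono inter_subset_left) (a := 0) fun X hX =>
      hXs.2 X hX.1 (dist_pos.1 (hδ.trans_le hX.2))
  exact ⟨c, c_pos, fun X hX far => hc X ⟨hX, far⟩⟩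

end Equilibrium

end MatrixGame

namespace MatrixGame

variable {ι : Type*} (G : MatrixGame ι)

/-- The profile of Hermitian parts of a profile of complex matrices. -/
def hermPart : G.MatrixProfile →ₗ[ℝ] G.Profile :=
  LinearMap.pi fun i => Herm.ofMatrixₗ (G.M i) ∘ₗ LinearMap.proj i

/-- The Hermitian part of the gradient estimate `V(X) + z`. -/
def gradEstimate [DecidableEq ι] (X : G.Profile) (z : G.MatrixProfile) : G.Profile :=
  G.gradProfile X + G.hermPart z

theorem score_succ [DecidableEq ι] (γ : ℕ → ℝ) (Y₀ : G.Profile) (z : ℕ → G.MatrixProfile)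
    (n : ℕ) : G.score γ Y₀ z (n + 1) =
      G.score γ Y₀ z n + γ n • G.gradEstimate (G.mxl γ Y₀ z n) (z n) :=
  funext fun i => congrArg (fun W => G.score γ Y₀ z n i + γ n • W)
    (Herm.ofMatrix_toMatrix_add _ (z n i))

theorem continuous_choice : Continuous G.choice :=
  continuous_pi fun i => (Herm.continuous_expProj (G.A i)).comp (continuous_apply i)

section BlockNorm

variable {G}

theorem singularNorm_le_blockNorm [Finite ι] (z : G.MatrixProfile) (i : ι) :
    singularNorm (z i) ≤ G.blockNorm z :=
  le_ciSup (f := fun i => singularNorm (z i)) (Finite.bddAbove_range _) i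

theorem exists_norm_le_mul_blockNorm [Finite ι] {F : Type*} [NormedAddCommGroup F]
    [NormedSpace ℝ F] (L : G.MatrixProfile →ₗ[ℝ] F) :
    ∃ C, 0 ≤ C ∧ ∀ z, ‖L z‖ ≤ C * G.blockNorm z := by
  classical
  have := Fintype.ofFinite ι
  let block (i : ι) := L ∘ₗ LinearMap.single ℝ (fun i => Matrix (Fin (G.M i)) (Fin (G.M i)) ℂ) i
  choose C C_nonneg hC using fun i => exists_norm_le_mul_singularNorm (block i)
  refine ⟨∑ i, C i, Finset.sum_nonneg fun i _ => C_nonneg i, fun z => ?_⟩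
  calc ‖L z‖ = ‖∑ i, block i (z i)‖ := by
        simp only [block, LinearMap.comp_apply, ← map_sum, LinearMap.coe_single,
          Finset.univ_sum_single]
    _ ≤ ∑ i, C i * G.blockNorm z := norm_sum_le_of_le _ fun i _ =>
        (hC i (z i)).trans (mul_le_mul_of_nonneg_left (singularNorm_le_blockNorm z i) (C_nonneg i))
    _ = (∑ i, C i) * G.blockNorm z := (Finset.sum_mul _ _ _).symm

variable [Fintype ι] [DecidableEq ι]

theorem exists_norm_gradEstimate_sq_le (hV : ContinuousOn G.gradProfile G.feasible) :
    ∃ C, 0 ≤ C ∧ ∀ X ∈ G.feasible, ∀ z,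
      ‖G.gradEstimate X z‖ ^ 2 ≤ C * (1 + G.blockNorm z ^ 2) := by
  obtain ⟨B, hB⟩ := G.isCompact_feasible.exists_bound_of_continuousOn hV
  obtain ⟨C, -, hC⟩ := exists_norm_le_mul_blockNorm G.hermPart
  refine ⟨B ^ 2 + C ^ 2, by positivity, fun X hX z => ?_⟩
  have triangle : ‖G.gradEstimate X z‖ ≤ B + C * G.blockNorm z :=
    norm_add_le_of_le (hB X hX) (hC z)
  calc ‖G.gradEstimate X z‖ ^ 2 ≤ (B + C * G.blockNorm z) ^ 2 := by gcongr
    _ ≤ (B ^ 2 + C ^ 2) * (1 + G.blockNorm z ^ 2) := by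
        linarith [sq_nonneg (B * G.blockNorm z - C)]

end BlockNorm

variable [Fintype ι]

/-- The constant of the Lipschitz estimate for `choice` and of the second-order term in the
evolution of the energy. -/
def choiceLipschitz : ℝ := ∑ i, G.A i * (1 + ‖Herm.one (G.M i)‖)

/-- The Fenchel coupling between the action profile `X` and the score profile `Y`, up to a constant
depending only on `X`: the Lyapunov function of matrix exponential learning. -/
def energy (X Y : G.Profile) : ℝ := ∑ i, G.A i * (Y i).logPartition - G.pairing Y X

theorem choiceLipschitz_nonneg : 0 ≤ G.choiceLipschitz :=
  Finset.sum_nonneg fun i _ => mul_nonneg (G.A_pos i).le (by positivity)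

theorem dist_choice_le (Y W : G.Profile) :
    dist (G.choice Y) (G.choice W) ≤ G.choiceLipschitz * dist Y W := by
  refine (dist_pi_le_iff (mul_nonneg G.choiceLipschitz_nonneg dist_nonneg)).2 fun i => ?_
  have const_nonneg (j : ι) : 0 ≤ G.A j * (1 + ‖Herm.one (G.M j)‖) :=
    mul_nonneg (G.A_pos j).le (by positivity)
  calc dist (G.choice Y i) (G.choice W i) ≤
        G.A i * (1 + ‖Herm.one (G.M i)‖) * dist (Y i) (W i) := by
        rw [dist_eq_norm, dist_eq_norm]
        exact Herm.norm_expProj_sub_le (G.A_pos i).le (Y i) (W i)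
    _ ≤ G.choiceLipschitz * dist Y W :=
        mul_le_mul (Finset.single_le_sum (fun j _ => const_nonneg j) (Finset.mem_univ i))
          (dist_le_pi_dist Y W i) dist_nonneg G.choiceLipschitz_nonneg

variable {G}

theorem energy_nonneg {X : G.Profile} (hX : X ∈ G.feasible) (Y : G.Profile) :
    0 ≤ G.energy X Y := by
  rw [energy, sub_nonneg, pairing_apply]
  exact Finset.sum_le_sum fun i _ => Herm.inner_le_mul_logPartition (hX i) (Y i)

theorem energy_add_le (X Y W : G.Profile) : G.energy X (Y + W) ≤
    G.energy X Y + G.pairing W (G.choice Y - X) + G.choiceLipschitz * ‖W‖ ^ 2 := by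
  have player (i : ι) : G.A i * (Y i + W i).logPartition ≤ G.A i * (Y i).logPartition +
      inner ℝ (W i) (G.choice Y i) + G.A i * (1 + ‖Herm.one (G.M i)‖) * ‖W‖ ^ 2 := by
    have smooth := mul_le_mul_of_nonneg_left (Herm.logPartition_add_le (Y i) (W i)) (G.A_pos i).le
    have norm_sq : ‖W i‖ ^ 2 ≤ ‖W‖ ^ 2 := by gcongr; exact norm_le_pi_norm W i
    have first_order : inner ℝ (W i) (G.choice Y i) =
        G.A i * inner ℝ (Y i).normalized.exp (W i) := by
      rw [choice, Herm.expProj_eq, inner_smul_right, real_inner_comm]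
    have second_order := mul_le_mul_of_nonneg_left norm_sq
      (mul_nonneg (G.A_pos i).le (by positivity : 0 ≤ 1 + ‖Herm.one (G.M i)‖))
    linarith
  have total := Finset.sum_le_sum fun i (_ : i ∈ Finset.univ) => player i
  rw [Finset.sum_add_distrib, Finset.sum_add_distrib, ← Finset.sum_mul, ← pairing_apply] at total
  rw [energy, energy, choiceLipschitz, map_add, map_sub, add_apply]
  simp only [Pi.add_apply]
  linarith

section Dynamics

variable [DecidableEq ι] {γ : ℕ → ℝ} {n : ℕ}

theorem dist_mxl_succ_le (hγ : 0 ≤ γ n) (Y₀ : G.Profile) (z : ℕ → G.MatrixProfile) :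
    dist (G.mxl γ Y₀ z n) (G.mxl γ Y₀ z (n + 1)) ≤
      G.choiceLipschitz * (γ n * ‖G.gradEstimate (G.mxl γ Y₀ z n) (z n)‖) := by
  refine (G.dist_choice_le _ _).trans_eq ?_
  rw [score_succ, dist_self_add_right, norm_smul, Real.norm_of_nonneg hγ]

theorem energy_score_succ_add_le (X Y₀ : G.Profile) (z : ℕ → G.MatrixProfile) :
    G.energy X (G.score γ Y₀ z (n + 1)) + γ n * G.gap X (G.mxl γ Y₀ z n) ≤
      G.energy X (G.score γ Y₀ z n) +
        (γ n * G.pairing (G.hermPart (z n)) (G.mxl γ Y₀ z n - X) + G.choiceLipschitz *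
          (γ n ^ 2 * ‖G.gradEstimate (G.mxl γ Y₀ z n) (z n)‖ ^ 2)) := by
  have step := energy_add_le X (G.score γ Y₀ z n)
    (γ n • G.gradEstimate (G.mxl γ Y₀ z n) (z n))
  rw [← score_succ, map_smul, smul_apply, smul_eq_mul, norm_smul, mul_pow, Real.norm_eq_abs,
    sq_abs] at step
  have drift : G.pairing (G.gradEstimate (G.mxl γ Y₀ z n) (z n)) (G.mxl γ Y₀ z n - X) =
      G.pairing (G.hermPart (z n)) (G.mxl γ Y₀ z n - X) - G.gap X (G.mxl γ Y₀ z n) := by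
    rw [gradEstimate, map_add, add_apply, gap, ← neg_sub X, map_neg, map_neg]
    ring
  rw [show G.choice (G.score γ Y₀ z n) = G.mxl γ Y₀ z n from rfl, drift] at step
  linarith

theorem exists_energy_score_succ_add_le (hV : ContinuousOn G.gradProfile G.feasible)
    (X : G.Profile) : ∃ C, ∀ (γ : ℕ → ℝ) (Y₀ : G.Profile) (z : ℕ → G.MatrixProfile) (n : ℕ),
      G.energy X (G.score γ Y₀ z (n + 1)) + γ n * G.gap X (G.mxl γ Y₀ z n) ≤
        G.energy X (G.score γ Y₀ z n) +
          (γ n * G.pairing (G.hermPart (z n)) (G.mxl γ Y₀ z n - X) +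
            C * (γ n ^ 2 * (1 + G.blockNorm (z n) ^ 2))) := by
  obtain ⟨C, -, hC⟩ := exists_norm_gradEstimate_sq_le hV
  refine ⟨G.choiceLipschitz * C, fun γ Y₀ z n => (energy_score_succ_add_le X Y₀ z).trans ?_⟩
  rw [mul_assoc G.choiceLipschitz, mul_left_comm C]
  have K_nonneg := G.choiceLipschitz_nonneg
  gcongr
  exact hC _ (G.choice_mem_feasible _) _

theorem tendsto_dist_mxl_succ (hV : ContinuousOn G.gradProfile G.feasible) (hγ : ∀ n, 0 ≤ γ n)
    {Y₀ : G.Profile} {z : ℕ → G.MatrixProfile}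
    (hz : Summable fun n => γ n ^ 2 * (1 + G.blockNorm (z n) ^ 2)) :
    Tendsto (fun n => dist (G.mxl γ Y₀ z n) (G.mxl γ Y₀ z (n + 1))) atTop (𝓝 0) := by
  obtain ⟨C, -, hC⟩ := exists_norm_gradEstimate_sq_le hV
  have bound_sq (n : ℕ) : dist (G.mxl γ Y₀ z n) (G.mxl γ Y₀ z (n + 1)) ^ 2 ≤
      G.choiceLipschitz ^ 2 * C * (γ n ^ 2 * (1 + G.blockNorm (z n) ^ 2)) :=
    calc dist (G.mxl γ Y₀ z n) (G.mxl γ Y₀ z (n + 1)) ^ 2 ≤ (G.choiceLipschitz *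
          (γ n * ‖G.gradEstimate (G.mxl γ Y₀ z n) (z n)‖)) ^ 2 := by
          gcongr; exact dist_mxl_succ_le (hγ n) Y₀ z
      _ = G.choiceLipschitz ^ 2 * γ n ^ 2 * ‖G.gradEstimate (G.mxl γ Y₀ z n) (z n)‖ ^ 2 := by
          ring
      _ ≤ G.choiceLipschitz ^ 2 * γ n ^ 2 * (C * (1 + G.blockNorm (z n) ^ 2)) := by
          gcongr; exact hC _ (G.choice_mem_feasible _) _
      _ = _ := by ring
  refine squeeze_zero (fun n => dist_nonneg) (fun n => Real.le_sqrt_of_sq_le (bound_sq n)) ?_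
  simpa using (hz.tendsto_atTop_zero.const_mul (G.choiceLipschitz ^ 2 * C)).sqrt

theorem exists_dist_mxl_succ_le (hV : ContinuousOn G.gradProfile G.feasible) :
    ∃ C, 0 ≤ C ∧ ∀ {γ : ℕ → ℝ} {n : ℕ}, 0 ≤ γ n → ∀ (Y₀ : G.Profile) (z : ℕ → G.MatrixProfile),
      dist (G.mxl γ Y₀ z n) (G.mxl γ Y₀ z (n + 1)) ≤
        C * (γ n * (1 + G.blockNorm (z n) ^ 2)) := by
  obtain ⟨C, C_nonneg, hC⟩ := exists_norm_gradEstimate_sq_le hV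
  have K_nonneg := G.choiceLipschitz_nonneg
  refine ⟨G.choiceLipschitz * (1 + C), by positivity, fun {γ n} hγ Y₀ z => ?_⟩
  have norm_le : ‖G.gradEstimate (G.mxl γ Y₀ z n) (z n)‖ ≤
      (1 + C) * (1 + G.blockNorm (z n) ^ 2) := by
    have norm_sq_le := hC _ (G.choice_mem_feasible (G.score γ Y₀ z n)) (z n)
    change ‖G.gradEstimate (G.mxl γ Y₀ z n) (z n)‖ ^ 2 ≤ _ at norm_sq_le
    linarith [sq_nonneg (‖G.gradEstimate (G.mxl γ Y₀ z n) (z n)‖ - 1 / 2),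
      sq_nonneg (G.blockNorm (z n))]
  calc dist (G.mxl γ Y₀ z n) (G.mxl γ Y₀ z (n + 1)) ≤
        G.choiceLipschitz * (γ n * ‖G.gradEstimate (G.mxl γ Y₀ z n) (z n)‖) :=
        dist_mxl_succ_le hγ Y₀ z
    _ ≤ G.choiceLipschitz * (γ n * ((1 + C) * (1 + G.blockNorm (z n) ^ 2))) := by gcongr
    _ = _ := by ring

theorem IsGloballyStable.tendsto_mxl (hV : ContinuousOn G.gradProfile G.feasible)
    {Xs : G.Profile} (hXs : G.IsGloballyStable Xs) (hγ : ∀ n, 0 ≤ γ n) (hγ_sum : ¬ Summable γ)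
    {Y₀ : G.Profile} {z : ℕ → G.MatrixProfile}
    (hz : Summable fun n => γ n ^ 2 * (1 + G.blockNorm (z n) ^ 2))
    (h_gap : Summable fun n =>
      γ n * (G.gap Xs (G.mxl γ Y₀ z n) * (1 + G.blockNorm (z n) ^ 2))) :
    Tendsto (G.mxl γ Y₀ z) atTop (𝓝 Xs) := by
  have weight_nonneg (n : ℕ) : 0 ≤ γ n * (1 + G.blockNorm (z n) ^ 2) :=
    mul_nonneg (hγ n) (by positivity)
  have gap_nonneg (n : ℕ) : 0 ≤ G.gap Xs (G.mxl γ Y₀ z n) :=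
    hXs.gap_nonneg (G.choice_mem_feasible _)
  have far_summable (δ : ℝ) (hδ : δ > 0) : Summable ({n | δ ≤ dist (G.mxl γ Y₀ z n) Xs}.indicator
      fun n => γ n * (1 + G.blockNorm (z n) ^ 2)) := by
    obtain ⟨c, c_pos, hc⟩ := hXs.exists_le_gap hV hδ
    refine (h_gap.mul_left c⁻¹).of_nonneg_of_le
      (fun n => indicator_nonneg (fun n _ => weight_nonneg n) n) fun n => ?_
    rw [← mul_assoc (γ n), mul_right_comm (γ n), ← mul_assoc, mul_comm c⁻¹, mul_assoc]
    refine indicator_apply_le' (fun far => ?_) fun _ =>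
      mul_nonneg (weight_nonneg n) (mul_nonneg (inv_nonneg.2 c_pos.le) (gap_nonneg n))
    exact le_mul_of_one_le_right (weight_nonneg n)
      ((one_le_inv_mul₀ c_pos).2 (hc _ (G.choice_mem_feasible _) far))
  obtain ⟨C, -, hC⟩ := exists_dist_mxl_succ_le hV
  refine tendsto_of_summable_indicator hγ_sum (tendsto_dist_mxl_succ hV hγ hz)
    (fun δ hδ => ?_) fun δ hδ => ?_
  · exact (far_summable δ hδ).of_nonneg_of_le (fun n => indicator_nonneg (fun n _ => hγ n) n)
      fun n => indicator_le_indicator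
        (le_mul_of_one_le_right (hγ n) (le_add_of_nonneg_right (sq_nonneg _)))
  · refine ((far_summable δ hδ).mul_left C).of_nonneg_of_le
      (fun n => indicator_nonneg (fun n _ => dist_nonneg) n) fun n => ?_
    rw [← indicator_const_mul]
    exact indicator_le_indicator (hC (hγ n) Y₀ z)

end Dynamics

end MatrixGame

namespace MatrixGame

variable {ι : Type*} (G : MatrixGame ι) [DecidableEq ι]

/-- The profile of matrices whose only nonzero entry is the given number, at position `p`: the
entries of a random profile are known to be measurable and centered, and linear maps are expanded
along them. -/
def entryMap (p : Σ i, Fin (G.M i) × Fin (G.M i)) : ℂ →ₗ[ℝ] G.MatrixProfile :=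
  LinearMap.single ℝ (fun i => Matrix (Fin (G.M i)) (Fin (G.M i)) ℂ) p.1 ∘ₗ
    Matrix.singleLinearMap ℝ p.2.1 p.2.2

variable {G}

theorem sum_entryMap [Fintype ι] (z : G.MatrixProfile) :
    ∑ p, G.entryMap p (z p.1 p.2.1 p.2.2) = z :=
  calc ∑ p, G.entryMap p (z p.1 p.2.1 p.2.2) =
        ∑ i, ∑ a, ∑ b, Pi.single i (Matrix.single a b (z i a b)) := by
        rw [Fintype.sum_sigma]
        exact Finset.sum_congr rfl fun i _ => Fintype.sum_prod_type _
    _ = ∑ i, Pi.single i (∑ a, ∑ b, Matrix.single a b (z i a b)) := by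
        simp only [← LinearMap.single_apply ℝ, map_sum]
    _ = z := by simp only [← Matrix.matrix_eq_sum_single, Finset.univ_sum_single]

section Noise

variable {F : Type*} [NormedAddCommGroup F] [NormedSpace ℝ F]
variable {Ω : Type*} [MeasurableSpace Ω]

theorem apply_eq_sum_entryMap [Fintype ι] (L : G.MatrixProfile →ₗ[ℝ] F) (z : G.MatrixProfile) :
    L z = ∑ p, (L ∘ₗ G.entryMap p).toContinuousLinearMap (z p.1 p.2.1 p.2.2) := by
  conv_lhs => rw [← sum_entryMap z, map_sum]
  rfl

variable [Finite ι]

omit [DecidableEq ι] in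
theorem stronglyMeasurable_linearMap_comp (L : G.MatrixProfile →ₗ[ℝ] F) {z : Ω → G.MatrixProfile}
    (hz : ∀ i a b, Measurable fun ω => z ω i a b) : StronglyMeasurable fun ω => L (z ω) := by
  classical
  have := Fintype.ofFinite ι
  simp only [apply_eq_sum_entryMap L]
  exact Finset.stronglyMeasurable_fun_sum _ fun p _ =>
    (ContinuousLinearMap.continuous _).comp_stronglyMeasurable (hz _ _ _).stronglyMeasurable

theorem measurable_score (hV : ContinuousOn G.gradProfile G.feasible) (γ : ℕ → ℝ) (Y₀ : G.Profile)
    {Z : ℕ → Ω → G.MatrixProfile} (hZ : ∀ n i a b, Measurable fun ω => Z n ω i a b) (n : ℕ) :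
    Measurable fun ω => G.score γ Y₀ (fun k => Z k ω) n := by
  have := Fintype.ofFinite ι
  induction n with
  | zero => exact measurable_const
  | succ n ih =>
    have grad_meas : Measurable fun ω => G.gradProfile (G.mxl γ Y₀ (fun k => Z k ω) n) :=
      measurable_comp_of_continuousOn hV (G.continuous_choice.measurable.comp ih)
        fun ω => G.choice_mem_feasible _
    have noise_meas := (stronglyMeasurable_linearMap_comp G.hermPart (hZ n)).measurable
    simp only [score_succ]
    exact ih.add ((grad_meas.add noise_meas).const_smul (γ n))

theorem measurable_mxl (hV : ContinuousOn G.gradProfile G.feasible) (γ : ℕ → ℝ) (Y₀ : G.Profile)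
    {Z : ℕ → Ω → G.MatrixProfile} (hZ : ∀ n i a b, Measurable fun ω => Z n ω i a b) (n : ℕ) :
    Measurable fun ω => G.mxl γ Y₀ (fun k => Z k ω) n :=
  G.continuous_choice.measurable.comp (measurable_score hV γ Y₀ hZ n)

namespace IsAdmissibleNoise

variable {μ : Measure Ω} {γ : ℕ → ℝ} {Y₀ : G.Profile}
  {Z : ℕ → Ω → G.MatrixProfile} {σ : ℝ}

theorem integrable_comp_mxl_mul (hZ : G.IsAdmissibleNoise μ γ Y₀ Z σ)
    (hV : ContinuousOn G.gradProfile G.feasible) {h : G.Profile → ℝ}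
    (hh : ContinuousOn h G.feasible) (n : ℕ) {f : Ω → ℝ} (hf : Integrable f μ) :
    Integrable (fun ω => h (G.mxl γ Y₀ (fun k => Z k ω) n) * f ω) μ := by
  obtain ⟨C, hC⟩ := G.isCompact_feasible.exists_bound_of_continuousOn hh
  exact hf.bdd_mul (measurable_comp_of_continuousOn hh (measurable_mxl hV γ Y₀ hZ.measurable n)
    fun ω => G.choice_mem_feasible _).aestronglyMeasurable
    (ae_of_all _ fun ω => hC _ (G.choice_mem_feasible _))

variable [IsFiniteMeasure μ]

omit [Finite ι] in
theorem integrable_one_add_sq (hZ : G.IsAdmissibleNoise μ γ Y₀ Z σ) (n : ℕ) :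
    Integrable (fun ω => 1 + G.blockNorm (Z n ω) ^ 2) μ :=
  (integrable_const 1).add (hZ.integrable_sq n)

theorem integrable_linearMap_comp (hZ : G.IsAdmissibleNoise μ γ Y₀ Z σ)
    (L : G.MatrixProfile →ₗ[ℝ] F) (n : ℕ) : Integrable (fun ω => L (Z n ω)) μ := by
  obtain ⟨C, C_nonneg, hC⟩ := exists_norm_le_mul_blockNorm L
  refine ((hZ.integrable_one_add_sq n).const_mul C).mono'
    (stronglyMeasurable_linearMap_comp L (hZ.measurable n)).aestronglyMeasurable
    (ae_of_all _ fun ω => (hC (Z n ω)).trans ?_)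
  refine mul_le_mul_of_nonneg_left ?_ C_nonneg
  linarith [sq_nonneg (G.blockNorm (Z n ω) - 1 / 2)]

theorem condExp_linearMap_comp [CompleteSpace F] (hZ : G.IsAdmissibleNoise μ γ Y₀ Z σ)
    (L : G.MatrixProfile →ₗ[ℝ] F) (n : ℕ) :
    μ[fun ω => L (Z n ω) |
      MeasurableSpace.comap (fun ω => G.mxl γ Y₀ (fun k => Z k ω) n) inferInstance] =ᵐ[μ] 0 := by
  have := Fintype.ofFinite ι
  simp only [apply_eq_sum_entryMap L]
  refine condExp_sum_clm_eq_zero (κ := Σ i, Fin (G.M i) × Fin (G.M i))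
    (g := fun p ω => Z n ω p.1 p.2.1 p.2.2) (fun p => ?_)
    (fun p => hZ.zero_mean n p.1 p.2.1 p.2.2) _
  exact hZ.integrable_linearMap_comp
    (Matrix.entryLinearMap ℝ ℂ p.2.1 p.2.2 ∘ₗ LinearMap.proj p.1) n

theorem integrable_comp_mxl (hZ : G.IsAdmissibleNoise μ γ Y₀ Z σ)
    (hV : ContinuousOn G.gradProfile G.feasible) {h : G.Profile → ℝ}
    (hh : ContinuousOn h G.feasible) (n : ℕ) :
    Integrable (fun ω => h (G.mxl γ Y₀ (fun k => Z k ω) n)) μ := by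
  simpa only [mul_one] using hZ.integrable_comp_mxl_mul hV hh n (integrable_const 1)

theorem integral_comp_mxl_mul_le (hZ : G.IsAdmissibleNoise μ γ Y₀ Z σ)
    (hV : ContinuousOn G.gradProfile G.feasible) {h : G.Profile → ℝ}
    (hh : ContinuousOn h G.feasible) (hh_nonneg : ∀ X ∈ G.feasible, 0 ≤ h X) (n : ℕ) :
    ∫ ω, h (G.mxl γ Y₀ (fun k => Z k ω) n) * (1 + G.blockNorm (Z n ω) ^ 2) ∂μ ≤
      (1 + σ ^ 2) * ∫ ω, h (G.mxl γ Y₀ (fun k => Z k ω) n) ∂μ := by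
  have past_le := (measurable_mxl hV γ Y₀ hZ.measurable n).comap_le
  have adapted : Measurable[MeasurableSpace.comap (fun ω => G.mxl γ Y₀ (fun k => Z k ω) n)
      inferInstance] fun ω => h (G.mxl γ Y₀ (fun k => Z k ω) n) :=
    measurable_comp_of_continuousOn hh (comap_measurable _) fun ω => G.choice_mem_feasible _
  refine integral_mul_le_of_condExp_le past_le adapted.stronglyMeasurable
    (fun ω => hh_nonneg _ (G.choice_mem_feasible _)) (hZ.integrable_comp_mxl hV hh n)
    (hZ.integrable_comp_mxl_mul hV hh n (hZ.integrable_one_add_sq n))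
    (hZ.integrable_one_add_sq n) ?_
  filter_upwards [condExp_add (integrable_const 1) (hZ.integrable_sq n) _, hZ.mean_sq n]
    with ω condExp_eq sq_le
  refine condExp_eq.trans_le ?_
  rw [Pi.add_apply, condExp_const past_le]
  exact add_le_add_right sq_le 1

theorem integral_one_add_sq_le (hZ : G.IsAdmissibleNoise μ γ Y₀ Z σ)
    (hV : ContinuousOn G.gradProfile G.feasible) (n : ℕ) :
    ∫ ω, (1 + G.blockNorm (Z n ω) ^ 2) ∂μ ≤ (1 + σ ^ 2) * μ.real univ := by
  simpa using hZ.integral_comp_mxl_mul_le hV (h := 1) continuousOn_const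
    (fun _ _ => zero_le_one) n

theorem summable_integral_sq_mul (hZ : G.IsAdmissibleNoise μ γ Y₀ Z σ)
    (hV : ContinuousOn G.gradProfile G.feasible) (hγ_sq : Summable fun n => γ n ^ 2) :
    Summable fun n => γ n ^ 2 * ∫ ω, (1 + G.blockNorm (Z n ω) ^ 2) ∂μ :=
  (hγ_sq.mul_right _).of_nonneg_of_le
    (fun n => mul_nonneg (sq_nonneg _) (integral_nonneg fun ω => by positivity))
    fun n => mul_le_mul_of_nonneg_left (hZ.integral_one_add_sq_le hV n) (sq_nonneg _)

variable [Fintype ι]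

theorem integrable_pairing_hermPart (hZ : G.IsAdmissibleNoise μ γ Y₀ Z σ)
    (hV : ContinuousOn G.gradProfile G.feasible) (X : G.Profile) (n : ℕ) :
    Integrable (fun ω =>
      G.pairing (G.hermPart (Z n ω)) (G.mxl γ Y₀ (fun k => Z k ω) n - X)) μ := by
  obtain ⟨C, hC⟩ := G.isCompact_feasible.exists_bound_of_continuousOn
    (f := fun W => W - X) (by fun_prop)
  exact G.pairing.flip.integrable_of_bilin_of_bdd_left C
    ((measurable_mxl hV γ Y₀ hZ.measurable n).sub_const X).aestronglyMeasurable
    (ae_of_all _ fun ω => hC _ (G.choice_mem_feasible _))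
    (hZ.integrable_linearMap_comp G.hermPart n)

theorem integral_pairing_hermPart_eq_zero (hZ : G.IsAdmissibleNoise μ γ Y₀ Z σ)
    (hV : ContinuousOn G.gradProfile G.feasible) (X : G.Profile) (n : ℕ) :
    ∫ ω, G.pairing (G.hermPart (Z n ω)) (G.mxl γ Y₀ (fun k => Z k ω) n - X) ∂μ = 0 :=
  integral_bilin_eq_zero_of_condExp_eq_zero
    (measurable_mxl hV γ Y₀ hZ.measurable n).comap_le G.pairing.flip
    ((comap_measurable _).sub_const X).stronglyMeasurable
    (hZ.integrable_pairing_hermPart hV X n) (hZ.integrable_linearMap_comp G.hermPart n)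
    (hZ.condExp_linearMap_comp G.hermPart n)

theorem summable_integral_gap (hZ : G.IsAdmissibleNoise μ γ Y₀ Z σ)
    (hV : ContinuousOn G.gradProfile G.feasible) (hγ : ∀ n, 0 ≤ γ n)
    (hγ_sq : Summable fun n => γ n ^ 2) {Xs : G.Profile} (hXs : G.IsGloballyStable Xs) :
    Summable fun n => γ n * ∫ ω, G.gap Xs (G.mxl γ Y₀ (fun k => Z k ω) n) ∂μ := by
  obtain ⟨C, hC⟩ := exists_energy_score_succ_add_le hV Xs
  have noise_int (n : ℕ) := (hZ.integrable_pairing_hermPart hV Xs n).const_mul (γ n)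
  have square_int (n : ℕ) := ((hZ.integrable_one_add_sq n).const_mul (γ n ^ 2)).const_mul C
  have error_int (n : ℕ) := (noise_int n).add (square_int n)
  have error_summable : Summable fun n => ∫ ω,
      (γ n * G.pairing (G.hermPart (Z n ω)) (G.mxl γ Y₀ (fun k => Z k ω) n - Xs) +
        C * (γ n ^ 2 * (1 + G.blockNorm (Z n ω) ^ 2))) ∂μ := by
    refine ((hZ.summable_integral_sq_mul hV hγ_sq).mul_left C).congr fun n => ?_
    rw [integral_add (noise_int n) (square_int n), integral_const_mul, integral_const_mul,
      integral_const_mul, hZ.integral_pairing_hermPart_eq_zero hV, mul_zero, zero_add]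
  simp only [← integral_const_mul]
  exact summable_integral_of_add_le_add
    (e := fun n ω => G.energy Xs (G.score γ Y₀ (fun k => Z k ω) n))
    (fun n ω => energy_nonneg hXs.1 _) (integrable_const (G.energy Xs Y₀))
    (fun n ω => mul_nonneg (hγ n) (hXs.gap_nonneg (G.choice_mem_feasible _)))
    (fun n => (hZ.integrable_comp_mxl hV (continuousOn_gap hV Xs) n).const_mul (γ n))
    error_int error_summable fun n ω => hC γ Y₀ (fun k => Z k ω) n

theorem ae_tendsto_mxl (hZ : G.IsAdmissibleNoise μ γ Y₀ Z σ)
    (hV : ContinuousOn G.gradProfile G.feasible) (hγ : ∀ n, 0 ≤ γ n)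
    (hγ_sq : Summable fun n => γ n ^ 2) (hγ_sum : ¬ Summable γ) {Xs : G.Profile}
    (hXs : G.IsGloballyStable Xs) :
    ∀ᵐ ω ∂μ, Tendsto (fun n => G.mxl γ Y₀ (fun k => Z k ω) n) atTop (𝓝 Xs) := by
  have gap_cont := continuousOn_gap hV Xs
  have gap_nonneg (X : G.Profile) : X ∈ G.feasible → 0 ≤ G.gap Xs X := hXs.gap_nonneg
  have ae_summable_sq : ∀ᵐ ω ∂μ, Summable fun n => γ n ^ 2 * (1 + G.blockNorm (Z n ω) ^ 2) := by
    refine ae_summable_of_summable_integral (fun n => (hZ.integrable_one_add_sq n).const_mul _)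
      (fun n ω => by positivity) ?_
    simpa only [integral_const_mul] using hZ.summable_integral_sq_mul hV hγ_sq
  have ae_summable_gap : ∀ᵐ ω ∂μ, Summable fun n => γ n *
      (G.gap Xs (G.mxl γ Y₀ (fun k => Z k ω) n) * (1 + G.blockNorm (Z n ω) ^ 2)) := by
    have nonneg (n : ℕ) (ω : Ω) : 0 ≤ γ n *
        (G.gap Xs (G.mxl γ Y₀ (fun k => Z k ω) n) * (1 + G.blockNorm (Z n ω) ^ 2)) :=
      mul_nonneg (hγ n) (mul_nonneg (gap_nonneg _ (G.choice_mem_feasible _)) (by positivity))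
    refine ae_summable_of_summable_integral (fun n =>
      (hZ.integrable_comp_mxl_mul hV gap_cont n (hZ.integrable_one_add_sq n)).const_mul _) nonneg
      (((hZ.summable_integral_gap hV hγ hγ_sq hXs).mul_left (1 + σ ^ 2)).of_nonneg_of_le
        (fun n => integral_nonneg (nonneg n)) fun n => ?_)
    rw [integral_const_mul, mul_left_comm (1 + σ ^ 2)]
    exact mul_le_mul_of_nonneg_left
      (hZ.integral_comp_mxl_mul_le hV gap_cont gap_nonneg n) (hγ n)
  filter_upwards [ae_summable_sq, ae_summable_gap] with ω summable_sq summable_gap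
  exact hXs.tendsto_mxl hV hγ hγ_sum summable_sq summable_gap

end IsAdmissibleNoise

end Noise

end MatrixGame

end

theorem mainTheorem5 {ι : Type*} [Fintype ι] [DecidableEq ι] (G : MatrixGame ι)
    (hconc : G.IndividuallyConcave) (hsmooth : G.IndividuallySmooth)
    (hD : ∀ X ∈ G.feasible, G.HessianNegDef X) :
    ∃ Xstar : G.Profile, G.IsNash Xstar ∧ (∀ X : G.Profile, G.IsNash X → X = Xstar) ∧
      ∀ {Ω : Type*} [MeasurableSpace Ω] (μ : Measure Ω) [IsProbabilityMeasure μ]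
        (γ : ℕ → ℝ) (Y₀ : G.Profile) (Z : ℕ → Ω → G.MatrixProfile) (σ : ℝ),
        (∀ n, 0 < γ n) → (Summable fun n => γ n ^ 2) → (¬ Summable γ) → 0 < σ →
        G.IsAdmissibleNoise μ γ Y₀ Z σ →
        ∀ᵐ ω ∂μ, Tendsto (fun n => G.mxl γ Y₀ (fun k => Z k ω) n) atTop (𝓝 Xstar) := by
  obtain ⟨Xs, hXs⟩ := MatrixGame.exists_isNash hconc hsmooth hD
  have stable := hXs.isGloballyStable hsmooth hD
  have continuousOn_grad := hsmooth.contDiffOn_gradProfile.continuousOn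
  refine ⟨Xs, hXs, fun X hX => stable.eq_of_isNash hsmooth hX, ?_⟩
  intro Ω _ μ _ γ Y₀ Z σ hγ hγ_sq hγ_sum _ hZ
  exact hZ.ae_tendsto_mxl continuousOn_grad (fun n => (hγ n).le) hγ_sq hγ_sum stable
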